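/- **Definitions.** An extended finite automaton (EFA) $E=(Q,\Sigma,X,Q_0,Q_m,Y,Y_0,R)$ has finite sets $Q$ of state tags and $\Sigma$ of event tags, domains $X$ and $Y$ of event and state parameters, initial and marked tags $Q_0,Q_m\subseteq Q$, initial parameters $Y_0\subseteq Y$, and a finite set $R$ of symbolic transitions $q\xrightarrow[k]{\sigma:\varphi:\xi}\hat q$ ($q,\hat q\in Q$, $\sigma\in\Sigma$, $k\ge 0$, a guard $\varphi\subseteq Y\times X^k$ and an update $\xi:Y\times X^k\to Y$), standing for all concrete transitions $(q,b)\xrightarrow{\sigma\langle a_1,\dots,a_k\rangle}(\hat q,\xi(b,a))$ with $(b,a)\in\varphi$. For $Q_1,Q_2\subseteq Q$, $L_{Q_1}^{Q_2}(E)$ is the set of labels $u$ of finite (possibly empty) paths $(q_1,b_1)\xrightarrow{u}(q_2,b_2)$ with $q_1\in Q_1$, $q_2\in Q_2$, and $b_1\in Y_0$ if $q_1\in Q_0$. The data string $\mathfrak D(u)$ is the sequence of the parameter tuples of $u$, event tags and empty tuples being removed. An observation function $\theta$ is given by a predicate on $X$: it erases from each tuple the elements that violate the predicate and then removes the empty tuples.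 Given $Q_s,Q_{ns}\subseteq Q_0$, $E$ is initial-state opaque w.r.t. $Q_s,Q_{ns},\theta$ if for every $u\in L_{Q_s}^{Q}(E)$ there is $v\in L_{Q_{ns}}^{Q}(E)$ with $\theta(\mathfrak D(u))=\theta(\mathfrak D(v))$. A two-counter machine program $P$ is a list of instructions $INC(r_j)$, $DEC(r_j)$ (not enabled if $r_j=0$), $JZ(r_j,z)$ (go to $z$ if $r_j=0$, otherwise to the next instruction) and $JMP(z)$ (go to $z$), $j\in\{1,2\}$; its configurations $(r_1,r_2,c)\in\mathbb N^3$ consist of the registers and the program counter, and $\varphi^{step}(y,x)$ says that $P$ moves from $y$ to $x$ by executing one instruction. Let $\varphi^{ini}$ (satisfiable) and $\varphi^{fin}$ be predicates on $\mathbb N^3$ describing the initial and the final configurations. Let $\widehat E_P$ be the EFA with $X=Y=\mathbb N^3$, states $q_0,\dots,q_4$, $Q_0=\{q_0,q_4\}$, $Y_0=\{x : \varphi^{ini}(x)\}$ and the following transitions of step-length $1$, where $y$ is the state parameter and $x$ the event parameter, "sto" replaces the state parameter by $x$ and $\Xi$ leaves it unchanged: $q_0\xrightarrow{\sigma_1:\varphi^{ini}(x):\mathrm{sto}}q_1$,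 $q_0\xrightarrow{\sigma_1:\neg\varphi^{ini}(x):\Xi}q_3$, $q_1\xrightarrow{\sigma_2:\varphi^{step}(y,x):\mathrm{sto}}q_2$, $q_1\xrightarrow{\sigma_2:\neg\varphi^{step}(y,x):\Xi}q_3$, $q_2\xrightarrow{\sigma_3:\neg\varphi^{fin}(x)\wedge x=y:\mathrm{sto}}q_1$, $q_2\xrightarrow{\sigma_3:x\ne y:\Xi}q_3$, $q_3\xrightarrow{\sigma_4:\top:\Xi}q_3$, $q_4\xrightarrow{\sigma_5:\top:\Xi}q_4$. Let $\widetilde E_P$ arise from $\widehat E_P$ by deleting $q_4$ with its loop and adding a state $q_5$ with $q_2\xrightarrow{\sigma_3:\varphi^{fin}(x)\wedge x=y:\Xi}q_5$ and $q_5\xrightarrow{\sigma_6:\top:\Xi}q_5$. **Theorem.** Initial-state opacity of EFAs is undecidable in general: no algorithm decides, given an EFA, sets $Q_s,Q_{ns}\subseteq Q_0$ and an observation function $\theta$, whether the EFA is initial-state opaque w.r.t. $Q_s,Q_{ns},\theta$. This holds already for $X=Y=\mathbb N^3$ with predicates that are Boolean combinations of inequalities between terms $v+c$ and $c$ ($v$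 a coordinate, $c\in\mathbb N$) and coordinatewise updates by such terms; satisfiability of these predicates is decidable. More precisely, for all $P$, $\varphi^{ini}$, $\varphi^{fin}$ as above, with $Q_s=\{q_4\}$, $Q_{ns}=\{q_0\}$ and the identity observation $\theta$: 1. the set of observations of the strings of $\widehat E_P$ from $q_4$ is $(\mathbb N^3)^*$; 2. $\widehat E_P$ is initial-state opaque iff the set of observations of the strings of $\widehat E_P$ from $q_0$ is $(\mathbb N^3)^*$ as well; 3. this is the case iff $q_5$ is not reachable in $\widetilde E_P$; 4. $q_5$ is reachable in $\widetilde E_P$ iff $P$ can reach a final configuration from an initial one by executing $n\ge1$ instructions. Moreover, it is undecidable, given $P$ and a configuration $a$, whether $\widehat E_P$ with $\varphi^{ini}(x)\Leftrightarrow x=a$ and $\varphi^{fin}(x)\Leftrightarrow$ "the program counter of $x$ points to no instruction of $P$" is initial-state opaque w.r.t. $\{q_4\}$, $\{q_0\}$ and the identity observation. -/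

import Mathlib

/-! ## Extended finite automata -/

/-- A symbolic transition `src --tag : guard : upd--> tgt` of step-length `k`: the event carries a
`k`-tuple of event parameters in `X`, the guard is a predicate on `Y × X ^ k` and the update is a
function `Y × X ^ k → Y`.  (For `k = 0` these are a predicate on `Y` and a function `Y → Y`.) -/
structure SymTrans (S A X Y : Type) where
  src : S
  tag : A
  k : ℕ
  guard : Set (Y × (Fin k → X))
  upd : Y → (Fin k → X) → Y
  tgt : S

/-- An extended finite automaton; state tags are taken from `S`, event tags from `A`. -/
structure EFA (S A X Y : Type) where
  /-- the finite set `Q` of state tags -/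
  states : Finset S
  /-- the finite set `Σ` of event tags -/
  events : Finset A
  /-- the set `Q₀` of tags of initial states -/
  start : Finset S
  /-- the set `Qₘ` of tags of marked states -/
  marked : Finset S
  /-- the domain of the parameter of initial states -/
  Y0 : Set Y
  /-- the set `R` of symbolic transitions -/
  trans : Set (SymTrans S A X Y)
  start_subset : start ⊆ states
  marked_subset : marked ⊆ states
  trans_finite : trans.Finite
  trans_mem : ∀ r ∈ trans, r.src ∈ states ∧ r.tag ∈ events ∧ r.tgt ∈ states

namespace EFA

variable {S A X Y : Type}

/-- Concrete transitions `(q, b) --σ⟨a₁, …, aₖ⟩--> (q', b')`; the parameterized event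
`σ⟨a₁, …, aₖ⟩` is the pair of its tag and the list of its parameters. -/
def Step (E : EFA S A X Y) (s : S × Y) (v : A × List X) (t : S × Y) : Prop :=
  ∃ r ∈ E.trans, ∃ a : Fin r.k → X,
    s.1 = r.src ∧ v = (r.tag, List.ofFn a) ∧ (s.2, a) ∈ r.guard ∧ t = (r.tgt, r.upd s.2 a)

/-- Combined concrete transitions, labelled by parameterized strings.  The constructor `nil` is the
implicit self-loop labelled with the empty string that every state carries. -/
inductive Path (E : EFA S A X Y) : S × Y → List (A × List X) → S × Y → Prop
  | nil (s : S × Y) : Path E s [] s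
  | cons {s t r : S × Y} {v : A × List X} {u : List (A × List X)} :
      E.Step s v t → Path E t u r → Path E s (v :: u) r

/-- The language `L_{Q₁}^{Q₂}(E)` between the sets of tags `Q₁` and `Q₂`. -/
def lang (E : EFA S A X Y) (Q₁ Q₂ : Finset S) : Set (List (A × List X)) :=
  {u | ∃ q₁ ∈ Q₁, ∃ q₂ ∈ Q₂, ∃ b₁ b₂ : Y,
    E.Path (q₁, b₁) u (q₂, b₂) ∧ (q₁ ∈ E.start → b₁ ∈ E.Y0)}

/-- The state tag `q` is reachable from the initial states. -/
def Reachable (E : EFA S A X Y) (q : S) : Prop := (E.lang E.start {q}).Nonempty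

end EFA

/-- The data string of a parameterized string: event tags are stripped, and parameterized events
without parameters disappear. -/
def dataString {A X : Type} (u : List (A × List X)) : List (List X) :=
  (u.map Prod.snd).filter (fun l => !l.isEmpty)

open Classical in
/-- The static observation function given by the observability condition `vis` on data elements:
unobservable elements are erased from every tuple, and empty tuples are removed. -/
noncomputable def observe {X : Type} (vis : Set X) (d : List (List X)) : List (List X) :=
  (d.map (fun l => l.filter (fun a => decide (a ∈ vis)))).filter (fun l => !l.isEmpty)

namespace EFA

variable {S A X Y : Type}

/-- The set of observations of the strings of `E` that start in `Q₁`. -/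
noncomputable def observationsFrom (E : EFA S A X Y) (Q₁ : Finset S) (vis : Set X) :
    Set (List (List X)) :=
  {w | ∃ u ∈ E.lang Q₁ E.states, w = observe vis (dataString u)}

/-- Initial-state opacity w.r.t. the secret initial states `Qs`, the non-secret initial states
`Qns` and the observation function given by `vis`. -/
def InitialStateOpaque (E : EFA S A X Y) (Qs Qns : Finset S) (vis : Set X) : Prop :=
  ∀ u ∈ E.lang Qs E.states, ∃ v ∈ E.lang Qns E.states,
    observe vis (dataString u) = observe vis (dataString v)

end EFA

/-- `X*`, as a set of data strings: all finite sequences of `1`-tuples. -/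
def allStrings (X : Type) : Set (List (List X)) :=
  Set.range (fun w : List X => w.map (fun a => [a]))

/-! ## Two-counter machines -/

/-- A configuration in `ℕ³`: entries `0` and `1` hold the registers, entry `2` the program counter.
-/
abbrev Config : Type := Fin 3 → ℕ

/-- Instructions of a two-counter machine: increment, decrement, jump to `z` if the register is
zero, unconditional jump to `z`. -/
inductive Instr : Type
  | inc (j : Fin 2)
  | dec (j : Fin 2)
  | jz (j : Fin 2) (z : ℕ)
  | jmp (z : ℕ)

/-- Instructions are finite data. -/
def Instr.equivSum : Instr ≃ (Fin 2 ⊕ Fin 2) ⊕ ((Fin 2 × ℕ) ⊕ ℕ) where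
  toFun
    | .inc j => .inl (.inl j)
    | .dec j => .inl (.inr j)
    | .jz j z => .inr (.inl (j, z))
    | .jmp z => .inr (.inr z)
  invFun
    | .inl (.inl j) => .inc j
    | .inl (.inr j) => .dec j
    | .inr (.inl (j, z)) => .jz j z
    | .inr (.inr z) => .jmp z
  left_inv := by rintro (_ | _ | _ | _) <;> rfl
  right_inv := by rintro ((_ | _) | (⟨_, _⟩ | _)) <;> rfl

instance : Primcodable Instr := Primcodable.ofEquiv _ Instr.equivSum

/-- A program: its `i`-th instruction, `1 ≤ i ≤ |P|`, is the list entry with index `i - 1`. -/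
abbrev Program : Type := List Instr

/-- `Instr.Rel I i y x`: executing `I`, which is the `i`-th instruction, turns the configuration `y`
into `x`.  Here `j.castSucc` is register `j` and `j.rev.castSucc` is the other register.
A register that holds `0` cannot be decremented. -/
def Instr.Rel : Instr → ℕ → Config → Config → Prop
  | .inc j, i, y, x => x j.castSucc = y j.castSucc + 1 ∧ x j.rev.castSucc = y j.rev.castSucc ∧
      y 2 = i ∧ x 2 = i + 1
  | .dec j, i, y, x => x j.castSucc + 1 = y j.castSucc ∧ x j.rev.castSucc = y j.rev.castSucc ∧
      y 2 = i ∧ x 2 = i + 1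
  | .jz j z, i, y, x => x 0 = y 0 ∧ x 1 = y 1 ∧ y 2 = i ∧
      x 2 = if y j.castSucc = 0 then z else i + 1
  | .jmp z, i, y, x => x 0 = y 0 ∧ x 1 = y 1 ∧ y 2 = i ∧ x 2 = z

/-- One step of the program `P`: the disjunction of the relations of its instructions. -/
def stepRel (P : Program) (y x : Config) : Prop :=
  ∃ i, ∃ h : i < P.length, (P[i]).Rel (i + 1) y x

/-- The program `P`, started in a configuration in `ini`, reaches a configuration in `fin` by
executing `n ≥ 1` instructions. -/
def Halts (P : Program) (ini fin : Set Config) : Prop :=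
  ∃ c ∈ ini, ∃ d ∈ fin, Relation.TransGen (stepRel P) c d

/-- The configurations in which the program counter points to no instruction of `P`. -/
def halted (P : Program) : Set Config := {c | ¬ (1 ≤ c 2 ∧ c 2 ≤ P.length)}

/-! ## The automata built from a program; the state `qᵢ` and the event `σᵢ` have tag `i` -/

/-- A symbolic transition of step-length `1` with parameters in `ℕ³`. -/
def trans1 (q σ : ℕ) (φ : Config → Config → Prop) (ξ : Config → Config → Config) (q' : ℕ) :
    SymTrans ℕ ℕ Config Config :=
  ⟨q, σ, 1, {p | φ p.1 (p.2 0)}, fun y a => ξ y (a 0), q'⟩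

/-- The update that stores the event parameter. -/
def updStore (_ x : Config) : Config := x

/-- The update that does nothing. -/
def updNone (y _ : Config) : Config := y

/-- The transitions among `q₀, q₁, q₂, q₃` shared by both automata. -/
def commonTrans (P : Program) (ini fin : Set Config) : Set (SymTrans ℕ ℕ Config Config) :=
  {trans1 0 1 (fun _ x => x ∈ ini) updStore 1,
   trans1 0 1 (fun _ x => x ∉ ini) updNone 3,
   trans1 1 2 (fun y x => stepRel P y x) updStore 2,
   trans1 1 2 (fun y x => ¬ stepRel P y x) updNone 3,
   trans1 2 3 (fun y x => x ∉ fin ∧ x = y) updStore 1,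
   trans1 2 3 (fun y x => x ≠ y) updNone 3,
   trans1 3 4 (fun _ _ => True) updNone 3}

/-- The automaton with states `q₀, …, q₄`, whose branch from `q₄` accepts every string. -/
def hatE (P : Program) (ini fin : Set Config) : EFA ℕ ℕ Config Config where
  states := {0, 1, 2, 3, 4}
  events := {1, 2, 3, 4, 5}
  start := {0, 4}
  marked := ∅
  Y0 := ini
  trans := commonTrans P ini fin ∪ {trans1 4 5 (fun _ _ => True) updNone 4}
  start_subset := by decide
  marked_subset := by decide
  trans_finite := by unfold commonTrans; exact Set.toFinite _
  trans_mem := by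
    rintro r ((rfl | rfl | rfl | rfl | rfl | rfl | rfl) | rfl) <;> simp [trans1]

/-- The automaton with states `q₀, q₁, q₂, q₃, q₅`, where `q₅` is entered when a final
configuration is found. -/
def tildeE (P : Program) (ini fin : Set Config) : EFA ℕ ℕ Config Config where
  states := {0, 1, 2, 3, 5}
  events := {1, 2, 3, 4, 6}
  start := {0}
  marked := ∅
  Y0 := ini
  trans := commonTrans P ini fin ∪
    {trans1 2 3 (fun y x => x ∈ fin ∧ x = y) updNone 5, trans1 5 6 (fun _ _ => True) updNone 5}
  start_subset := by decide
  marked_subset := by decide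
  trans_finite := by unfold commonTrans; exact Set.toFinite _
  trans_mem := by
    rintro r ((rfl | rfl | rfl | rfl | rfl | rfl | rfl) | (rfl | rfl)) <;> simp [trans1]

/-! ## Finite descriptions of EFAs

The domains of event and state parameters are `ℕ³`, and predicates are the Boolean combinations of
comparisons `s ≤ t` of terms of the form `c` or `v + c`, with `c` a numeral and `v` a variable. -/

/-- A variable `(i, j)` is the `j`-th entry of the `i`-th component of a tuple over `ℕ³`.
The term `(some v, c)` is `v + c`, and `(none, c)` is the numeral `c`. -/
abbrev PTerm : Type := Option (ℕ × Fin 3) × ℕ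

/-- The value of a term on a tuple over `ℕ³` (components beyond the length of the tuple read as `0`).
-/
def PTerm.eval (l : List Config) : PTerm → ℕ
  | (some (i, j), c) => (l.getD i 0) j + c
  | (none, c) => c

/-- Predicates in disjunctive normal form: a disjunction of conjunctions of literals, the literal
`(s, t)` being `s ≤ t`.  The negation of a literal is again a literal. -/
abbrev Pred : Type := List (List (PTerm × PTerm))

/-- Denotation of a predicate. -/
def Pred.Holds (φ : Pred) (l : List Config) : Prop :=
  ∃ cl ∈ φ, ∀ p ∈ cl, PTerm.eval l p.1 ≤ PTerm.eval l p.2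

/-- The predicates are closed under disjunction. -/
theorem Pred.exists_or (φ ψ : Pred) :
    ∃ χ : Pred, ∀ l, χ.Holds l ↔ (φ.Holds l ∨ ψ.Holds l) :=
  ⟨φ ++ ψ, fun l => by simp only [Pred.Holds, List.mem_append, or_and_right, _root_.exists_or]⟩

/-- The predicates are closed under conjunction. -/
theorem Pred.exists_and (φ ψ : Pred) :
    ∃ χ : Pred, ∀ l, χ.Holds l ↔ (φ.Holds l ∧ ψ.Holds l) := by
  refine ⟨φ.flatMap fun c => ψ.map fun d => c ++ d, fun l => ?_⟩
  simp only [Pred.Holds, List.mem_flatMap, List.mem_map]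
  constructor
  · rintro ⟨_, ⟨c, hc, d, hd, rfl⟩, h⟩
    exact ⟨⟨c, hc, fun p hp => h p (List.mem_append_left _ hp)⟩,
      ⟨d, hd, fun p hp => h p (List.mem_append_right _ hp)⟩⟩
  · rintro ⟨⟨c, hc, h₁⟩, ⟨d, hd, h₂⟩⟩
    exact ⟨c ++ d, ⟨c, hc, d, hd, rfl⟩, fun p hp =>
      (List.mem_append.1 hp).elim (h₁ p) (h₂ p)⟩

/-- The predicates are closed under negation. -/
theorem Pred.exists_not (φ : Pred) : ∃ χ : Pred, ∀ l, χ.Holds l ↔ ¬ φ.Holds l := by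
  induction φ with
  | nil => exact ⟨[[]], fun l => by simp [Pred.Holds]⟩
  | cons cl φ ih =>
    obtain ⟨χ, hχ⟩ := ih
    obtain ⟨ω, hω⟩ := Pred.exists_and
      (cl.map fun p => [((p.2.1, p.2.2 + 1), p.1)] : Pred) χ
    refine ⟨ω, fun l => ?_⟩
    have key : ∀ p : PTerm × PTerm,
        PTerm.eval l (p.2.1, p.2.2 + 1) ≤ PTerm.eval l p.1 ↔
          ¬ PTerm.eval l p.1 ≤ PTerm.eval l p.2 := by
      rintro ⟨s, ⟨_ | ⟨i, j⟩, c⟩⟩ <;> simp only [PTerm.eval] <;> omega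
    have h₁ : Pred.Holds (cl.map fun p => [((p.2.1, p.2.2 + 1), p.1)] : Pred) l ↔
        ¬ ∀ p ∈ cl, PTerm.eval l p.1 ≤ PTerm.eval l p.2 := by
      simp only [Pred.Holds, List.mem_map]
      push Not
      constructor
      · rintro ⟨_, ⟨p, hp, rfl⟩, h⟩
        exact ⟨p, hp, not_le.1 ((key p).1 (h _ (List.mem_singleton.2 rfl)))⟩
      · rintro ⟨p, hp, h⟩
        refine ⟨_, ⟨p, hp, rfl⟩, fun q hq => ?_⟩
        rw [List.mem_singleton.1 hq]
        exact (key p).2 (not_le.2 h)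
    have h₂ : Pred.Holds (cl :: φ) l ↔
        (∀ p ∈ cl, PTerm.eval l p.1 ≤ PTerm.eval l p.2) ∨ Pred.Holds φ l := by
      simp only [Pred.Holds, List.exists_mem_cons_iff]
    rw [hω, h₁, hχ, h₂, not_or]

/-- `φ`, as a predicate on `(ℕ³)ᵐ`, is satisfiable. -/
def Pred.Sat (m : ℕ) (φ : Pred) : Prop := ∃ l : List Config, l.length = m ∧ φ.Holds l

/-- Finite description of a symbolic transition.  In the guard and in the update, component `0` is
the state parameter and component `i`, `1 ≤ i ≤ k`, is the `i`-th event parameter; the update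
assigns a term to every entry of the target state parameter. -/
structure TransCode : Type where
  src : ℕ
  tag : ℕ
  k : ℕ
  guard : Pred
  upd : Fin 3 → PTerm
  tgt : ℕ

/-- Descriptions of transitions are finite data. -/
def TransCode.equivProd : TransCode ≃ ℕ × ℕ × ℕ × Pred × (Fin 3 → PTerm) × ℕ where
  toFun t := (t.src, t.tag, t.k, t.guard, t.upd, t.tgt)
  invFun p := ⟨p.1, p.2.1, p.2.2.1, p.2.2.2.1, p.2.2.2.2.1, p.2.2.2.2.2⟩
  left_inv _ := rfl
  right_inv _ := rfl

instance : Primcodable TransCode := Primcodable.ofEquiv _ TransCode.equivProd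

/-- The symbolic transition described by `t`. -/
def TransCode.toTrans (t : TransCode) : SymTrans ℕ ℕ Config Config :=
  ⟨t.src, t.tag, t.k, {p | t.guard.Holds (p.1 :: List.ofFn p.2)},
    fun y a j => PTerm.eval (y :: List.ofFn a) (t.upd j), t.tgt⟩

/-- An instance of the initial-state opacity problem: a finite description of an EFA, the secret and
the non-secret initial states, and the observability condition (a predicate on one element of `ℕ³`).
-/
structure OpacityInstance : Type where
  states : List ℕ
  events : List ℕ
  start : List ℕ
  marked : List ℕ
  Y0 : Pred
  trans : List TransCode
  secret : List ℕ
  nonsecret : List ℕ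
  vis : Pred

namespace OpacityInstance

/-- Instances are finite data. -/
def equivProd : OpacityInstance ≃
    List ℕ × List ℕ × List ℕ × List ℕ × Pred × List TransCode × List ℕ × List ℕ × Pred where
  toFun I := (I.states, I.events, I.start, I.marked, I.Y0, I.trans, I.secret, I.nonsecret, I.vis)
  invFun p := ⟨p.1, p.2.1, p.2.2.1, p.2.2.2.1, p.2.2.2.2.1, p.2.2.2.2.2.1, p.2.2.2.2.2.2.1,
    p.2.2.2.2.2.2.2.1, p.2.2.2.2.2.2.2.2⟩
  left_inv _ := rfl
  right_inv _ := rfl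

instance : Primcodable OpacityInstance := Primcodable.ofEquiv _ equivProd

/-- Well-formed instances: all tags are declared, and the (non-)secret states are initial. -/
structure WF (I : OpacityInstance) : Prop where
  start_subset : I.start ⊆ I.states
  marked_subset : I.marked ⊆ I.states
  trans_mem : ∀ t ∈ I.trans, t.src ∈ I.states ∧ t.tag ∈ I.events ∧ t.tgt ∈ I.states
  secret_subset : I.secret ⊆ I.start
  nonsecret_subset : I.nonsecret ⊆ I.start

/-- The EFA described by a well-formed instance. -/
def toEFA (I : OpacityInstance) (h : I.WF) : EFA ℕ ℕ Config Config where
  states := I.states.toFinset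
  events := I.events.toFinset
  start := I.start.toFinset
  marked := I.marked.toFinset
  Y0 := {y | I.Y0.Holds [y]}
  trans := {r | ∃ t ∈ I.trans, r = t.toTrans}
  start_subset := by
    intro q hq
    exact List.mem_toFinset.2 (h.start_subset (List.mem_toFinset.1 hq))
  marked_subset := by
    intro q hq
    exact List.mem_toFinset.2 (h.marked_subset (List.mem_toFinset.1 hq))
  trans_finite := by
    refine (I.trans.map TransCode.toTrans).finite_toSet.subset ?_
    rintro r ⟨t, ht, rfl⟩
    exact List.mem_map.2 ⟨t, ht, rfl⟩
  trans_mem := by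
    rintro r ⟨t, ht, rfl⟩
    simpa [TransCode.toTrans] using h.trans_mem t ht

/-- The described EFA is initial-state opaque. -/
def IsOpaque (I : OpacityInstance) (h : I.WF) : Prop :=
  (I.toEFA h).InitialStateOpaque I.secret.toFinset I.nonsecret.toFinset {x | I.vis.Holds [x]}

end OpacityInstance

/-! The branch of `hatE` from `q₄` reads every string, so opacity says that the branch from `q₀`
does too. From `q₀`, a string escapes to the all-accepting `q₃` at its first deviation from an
encoding `c, x₁, x₁, x₂, x₂, …` of a run of `P`: the first copy of a configuration is checked to be
a successor, the second to repeat it. A faithful encoding gets stuck only when the second copy is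
final. Hence some string is unreadable exactly when a run of at least one instruction meets `fin`
(`exists_not_hatE_reads_one`, `hatE_reads_one_two`). In `tildeE` that missing move leads to `q₅`,
whence `reachable_tildeE_five_iff`.

Undecidability comes from the halting problem for `Nat.Partrec.Code`. Register contents are
exponents of distinct primes in the first counter, and the second counter is empty between
operations. Multiplication, division and a divisibility test then act as increment, decrement and
zero test. The resulting fragments compute all primitive recursive functions
(`exists_frag_of_primrec`), and one more loop searches for a time bound at which `Code.evaln`
succeeds (`exists_program_search`). Finite flow graphs become programs with three instructions per
node. A search that never succeeds must be shown not to halt: the machine is deterministic and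
returns to the loop entry forever (`not_halts_flowProgram`).

The universal program is fixed and only its initial configuration `a` varies. So the reduction to
described EFAs has to compute only predicates for equality with `a` and its negation; all other
guards are constants that merely have to exist (`exists_computable_instance`).

Satisfiability is decidable by a small-model property: large gaps between the values of a valuation
can be shortened without falsifying a literal (`squash_add_le_squash_add`), which leaves a bounded
search. -/

/-! ## Flow graphs over two counters -/

/-- The operation at a node of a flow graph with nodes in `L`; the counter is selected by a Boolean.
`dec j z n` continues in `z` if the counter is zero, and otherwise decrements it and continues in
`n`. -/
inductive FlowOp (L : Type) : Type
  | inc (j : Bool) (n : L)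
  | dec (j : Bool) (z n : L)
  | halt

/-- The successor configuration. -/
def FlowOp.next {L : Type} : FlowOp L → ℕ × ℕ → Option (L × (ℕ × ℕ))
  | .inc false n, (a, b) => some (n, (a + 1, b))
  | .inc true n, (a, b) => some (n, (a, b + 1))
  | .dec false z _, (0, b) => some (z, (0, b))
  | .dec false _ n, (a + 1, b) => some (n, (a, b))
  | .dec true z _, (a, 0) => some (z, (a, 0))
  | .dec true _ n, (a, b + 1) => some (n, (a, b))
  | .halt, _ => none

/-- One step of the flow graph `δ`. -/
def FlowStep {L : Type} (δ : L → FlowOp L) (c d : L × (ℕ × ℕ)) : Prop :=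
  (δ c.1).next c.2 = some d

/-- A finite flow graph fragment with one entry and one exit.  `flow e x` is the fragment with its
nodes placed in `L` by `e` and its exit connected to `x`. -/
structure Frag : Type 1 where
  Lab : Type
  finite_lab : Finite Lab
  entry : Lab
  flow : ∀ {L : Type}, (Lab → L) → L → Lab → FlowOp L

namespace Frag

open Relation

/-- The fragment `c` is part of the flow graph `δ`. -/
def Embeds (c : Frag) {L : Type} (δ : L → FlowOp L) (e : c.Lab → L) (x : L) : Prop :=
  ∀ l, δ (e l) = c.flow e x l

/-- Started with counters `s`, the fragment reaches its exit with counters `t`. -/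
def Runs (c : Frag) (s t : ℕ × ℕ) : Prop :=
  ∀ (L : Type) (δ : L → FlowOp L) (e : c.Lab → L) (x : L), c.Embeds δ e x →
    ReflTransGen (FlowStep δ) (e c.entry, s) (x, t)

/-- Increment. -/
def incr (j : Bool) : Frag := ⟨Unit, inferInstance, (), fun _ x _ => .inc j x⟩

/-- Truncated decrement. -/
def decr (j : Bool) : Frag := ⟨Unit, inferInstance, (), fun _ x _ => .dec j x x⟩

/-- Sequential composition. -/
def seq (c d : Frag) : Frag where
  Lab := c.Lab ⊕ d.Lab
  finite_lab := by
    have := c.finite_lab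
    have := d.finite_lab
    infer_instance
  entry := .inl c.entry
  flow e x
    | .inl l => c.flow (e ∘ .inl) (e (.inr d.entry)) l
    | .inr l => d.flow (e ∘ .inr) x l

/-- While the counter is nonzero, decrement it and execute `c`. -/
def loop (j : Bool) (c : Frag) : Frag where
  Lab := Option c.Lab
  finite_lab := by
    have := c.finite_lab
    infer_instance
  entry := none
  flow e x
    | none => .dec j x (e (some c.entry))
    | some l => c.flow (e ∘ some) (e none) l

/-- While the first counter is divisible by `p`, execute `c`.  The test moves the first counter to
the second one, keeping track of the residue of the latter, and back again. -/
def loopDvd (p : ℕ) [NeZero p] (c : Frag) : Frag where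
  Lab := (ZMod p × Bool) ⊕ (Bool × Bool) ⊕ c.Lab
  finite_lab := by
    have := c.finite_lab
    have : Finite (ZMod p) := @Finite.of_fintype _ (ZMod.fintype p)
    infer_instance
  entry := .inl (0, false)
  flow e x
    | .inl (r, false) => .dec false (e (.inr (.inl (decide (r = 0), false)))) (e (.inl (r, true)))
    | .inl (r, true) => .inc true (e (.inl (r + 1, false)))
    | .inr (.inl (b, false)) =>
        .dec true (if b then e (.inr (.inr c.entry)) else x) (e (.inr (.inl (b, true))))
    | .inr (.inl (b, true)) => .inc false (e (.inr (.inl (b, false))))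
    | .inr (.inr l) => c.flow (fun l => e (.inr (.inr l))) (e (.inl (0, false))) l

theorem Embeds.step {c : Frag} {L : Type} {δ : L → FlowOp L} {e : c.Lab → L} {x : L}
    (h : c.Embeds δ e x) (l : c.Lab) {s : ℕ × ℕ} {d : L × (ℕ × ℕ)}
    (hd : (c.flow e x l).next s = some d) : FlowStep δ (e l, s) d := by
  rw [FlowStep, h, hd]

theorem runs_incr_false (a b : ℕ) : (incr false).Runs (a, b) (a + 1, b) := fun _ δ e x h =>
  .single (by rw [FlowStep, h]; rfl)

theorem runs_incr_true (a b : ℕ) : (incr true).Runs (a, b) (a, b + 1) := fun _ δ e x h =>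
  .single (by rw [FlowStep, h]; rfl)

theorem runs_decr_false (a b : ℕ) : (decr false).Runs (a + 1, b) (a, b) := fun _ δ e x h =>
  .single (by rw [FlowStep, h]; rfl)

theorem Runs.seq {c d : Frag} {s t u : ℕ × ℕ} (hc : c.Runs s t) (hd : d.Runs t u) :
    (c.seq d).Runs s u := fun _ δ e x h =>
  (hc _ δ (e ∘ .inl) (e (.inr d.entry)) fun l => h (.inl l)).trans
    (hd _ δ (e ∘ .inr) x fun l => h (.inr l))

theorem runs_loop_false_zero (c : Frag) (b : ℕ) : (loop false c).Runs (0, b) (0, b) :=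
  fun _ δ e x h => .single (by rw [FlowStep, h]; rfl)

theorem runs_loop_true_zero (c : Frag) (a : ℕ) : (loop true c).Runs (a, 0) (a, 0) :=
  fun _ δ e x h => .single (by rw [FlowStep, h]; rfl)

theorem runs_loop_false_succ {c : Frag} {a b : ℕ} {t u : ℕ × ℕ} (hc : c.Runs (a, b) t)
    (h : (loop false c).Runs t u) : (loop false c).Runs (a + 1, b) u := fun _ δ e x he =>
  (ReflTransGen.single (b := (e (some c.entry), (a, b))) (by rw [FlowStep, he]; rfl)).trans
    ((hc _ δ (e ∘ some) (e none) fun l => he (some l)).trans (h _ δ e x he))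

theorem runs_loop_true_succ {c : Frag} {a b : ℕ} {t u : ℕ × ℕ} (hc : c.Runs (a, b) t)
    (h : (loop true c).Runs t u) : (loop true c).Runs (a, b + 1) u := fun _ δ e x he =>
  (ReflTransGen.single (b := (e (some c.entry), (a, b))) (by rw [FlowStep, he]; rfl)).trans
    ((hc _ δ (e ∘ some) (e none) fun l => he (some l)).trans (h _ δ e x he))

section LoopDvd

variable {p : ℕ} [NeZero p] {c : Frag} {L : Type} {δ : L → FlowOp L}
  {e : (loopDvd p c).Lab → L} {x : L}

/-- Each round moves one unit and advances the residue in the node label, so the label stays the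
class of the second counter. Once the first counter is empty, the label is the class of the total.
-/
theorem loopDvd_count (h : (loopDvd p c).Embeds δ e x) (a b : ℕ) :
    ReflTransGen (FlowStep δ) (e (.inl ((b : ZMod p), false)), (a, b))
      (e (.inr (.inl (decide (p ∣ a + b), false))), (0, a + b)) := by
  induction a generalizing b with
  | zero =>
    refine .single (h.step (.inl ((b : ZMod p), false)) ?_)
    simp [loopDvd, FlowOp.next, ZMod.natCast_eq_zero_iff]
  | succ a ih =>
    refine .head (b := (e (.inl ((b : ZMod p), true)), (a, b)))
      (h.step (.inl ((b : ZMod p), false)) rfl) ?_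
    refine .head (b := (e (.inl (((b + 1 : ℕ) : ZMod p), false)), (a, b + 1)))
      (h.step (.inl ((b : ZMod p), true)) (by simp [loopDvd, FlowOp.next])) ?_
    have := ih (b + 1)
    rwa [show a + (b + 1) = a + 1 + b by omega] at this

/-- The verdict of the test survives in the node label while the counters are moved back. The final
zero test always costs a step, hence `TransGen`; infinite runs are later built from this strictness.
-/
theorem loopDvd_restore (h : (loopDvd p c).Embeds δ e x) (r : Bool) (a b : ℕ) :
    TransGen (FlowStep δ) (e (.inr (.inl (r, false))), (a, b))
      (if r then e (.inr (.inr c.entry)) else x, (a + b, 0)) := by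
  induction b generalizing a with
  | zero => exact .single (h.step (.inr (.inl (r, false))) rfl)
  | succ b ih =>
    refine .head (b := (e (.inr (.inl (r, true))), (a, b)))
      (h.step (.inr (.inl (r, false))) rfl) ?_
    refine .head (b := (e (.inr (.inl (r, false))), (a + 1, b)))
      (h.step (.inr (.inl (r, true))) rfl) ?_
    have := ih (a + 1)
    rwa [show a + 1 + b = a + (b + 1) by omega] at this

theorem loopDvd_test (h : (loopDvd p c).Embeds δ e x) (N : ℕ) :
    TransGen (FlowStep δ) (e (loopDvd p c).entry, (N, 0))
      (if p ∣ N then e (.inr (.inr c.entry)) else x, (N, 0)) := by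
  have h₁ := loopDvd_count h N 0
  have h₂ := loopDvd_restore h (decide (p ∣ N)) 0 N
  simp only [add_zero, Nat.cast_zero, zero_add, decide_eq_true_eq] at h₁ h₂
  exact h₂.trans_right h₁

theorem loopDvd_body (h : (loopDvd p c).Embeds δ e x) {N M : ℕ} (hN : p ∣ N)
    (hc : c.Runs (N, 0) (M, 0)) :
    TransGen (FlowStep δ) (e (loopDvd p c).entry, (N, 0)) (e (loopDvd p c).entry, (M, 0)) := by
  have h₁ := loopDvd_test h N
  rw [if_pos hN] at h₁
  exact h₁.trans_left (hc _ δ (fun l => e (.inr (.inr l))) _ fun l => h (.inr (.inr l)))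

end LoopDvd

theorem runs_loopDvd_of_not_dvd {p : ℕ} [NeZero p] (c : Frag) {N : ℕ} (h : ¬ p ∣ N) :
    (loopDvd p c).Runs (N, 0) (N, 0) := fun _ δ e x he => by
  have := loopDvd_test he N
  rw [if_neg h] at this
  exact this.to_reflTransGen

theorem runs_loopDvd_of_dvd {p : ℕ} [NeZero p] {c : Frag} {N M : ℕ} {t : ℕ × ℕ} (h : p ∣ N)
    (hc : c.Runs (N, 0) (M, 0)) (ht : (loopDvd p c).Runs (M, 0) t) :
    (loopDvd p c).Runs (N, 0) t := fun _ δ e x he =>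
  (loopDvd_body he h hc).to_reflTransGen.trans (ht _ δ e x he)

end Frag

/-! ## Flow graphs as two-counter machine programs -/

/-- One extra node (`none`) serves as the exit and halts; the nodes are then numbered. -/
theorem Frag.exists_fin_embeds (c : Frag) : ∃ (n : ℕ) (δ : Fin n → FlowOp (Fin n))
    (e : c.Lab → Fin n) (x : Fin n), c.Embeds δ e x ∧ δ x = .halt := by
  have := c.finite_lab
  obtain ⟨n, ⟨q⟩⟩ := Finite.exists_equiv_fin (Option c.Lab)
  refine ⟨n, fun i => match q.symm i with
    | none => .halt
    | some l => c.flow (fun l => q (some l)) (q none) l, fun l => q (some l), q none, ?_, ?_⟩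
  · intro l
    simp
  · simp

namespace FlowOp

/-- The number of a counter. -/
def counter (j : Bool) : Fin 2 := bif j then 1 else 0

/-- The instructions for the operation at a node take three places; `addr i` is the first one of
node `i`. -/
def addr {n : ℕ} (i : Fin n) : ℕ := 3 * i + 1

/-- The instructions for the operation at a node. -/
def block {n : ℕ} : FlowOp (Fin n) → ℕ → Instr
  | .inc j _, 0 => .inc (counter j)
  | .inc _ l, _ => .jmp (addr l)
  | .dec j z _, 0 => .jz (counter j) (addr z)
  | .dec j _ _, 1 => .dec (counter j)
  | .dec _ _ l, _ => .jmp (addr l)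
  | .halt, _ => .jmp 0

end FlowOp

open FlowOp Relation

/-- The program of a flow graph. -/
def flowProgram {n : ℕ} (δ : Fin n → FlowOp (Fin n)) : Program :=
  List.ofFn fun i : Fin (3 * n) => (δ ⟨i / 3, by omega⟩).block (i % 3)

/-- The machine configuration that corresponds to a configuration of a flow graph. -/
def flowConfig {n : ℕ} (c : Fin n × (ℕ × ℕ)) : Config := ![c.2.1, c.2.2, addr c.1]

/-- Program counters start at `1`: the instruction with list index `3 * i + r` sits at address `addr
i + r`. -/
theorem stepRel_flowProgram {n : ℕ} (δ : Fin n → FlowOp (Fin n)) (i : Fin n) (r : ℕ) (hr : r < 3)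
    {y x : Config} (h : ((δ i).block r).Rel (addr i + r) y x) : stepRel (flowProgram δ) y x := by
  refine ⟨3 * i + r, by simp [flowProgram]; omega, ?_⟩
  have h₁ : (3 * (i : ℕ) + r) / 3 = i := by omega
  have h₂ : (3 * (i : ℕ) + r) % 3 = r := by omega
  simp only [flowProgram, List.getElem_ofFn, h₁, h₂]
  rwa [addr, add_right_comm] at h

theorem FlowStep.transGen_stepRel {n : ℕ} {δ : Fin n → FlowOp (Fin n)} {c d : Fin n × (ℕ × ℕ)}
    (h : FlowStep δ c d) :
    TransGen (stepRel (flowProgram δ)) (flowConfig c) (flowConfig d) := by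
  obtain ⟨i, a, b⟩ := c
  rw [FlowStep] at h
  have st := stepRel_flowProgram δ i
  rcases hi : δ i with ⟨_ | _, l⟩ | ⟨_ | _, z, l⟩ | _ <;> rw [hi] at st h
  · obtain rfl : (l, (a + 1, b)) = d := by simpa [next] using h
    exact .head (b := ![a + 1, b, addr i + 1])
      (st 0 (by omega) (by simp [block, Instr.Rel, counter, flowConfig]))
      (.single (st 1 (by omega) (by simp [block, Instr.Rel, flowConfig])))
  · obtain rfl : (l, (a, b + 1)) = d := by simpa [next] using h
    exact .head (b := ![a, b + 1, addr i + 1])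
      (st 0 (by omega) (by simp [block, Instr.Rel, counter, flowConfig]))
      (.single (st 1 (by omega) (by simp [block, Instr.Rel, flowConfig])))
  · rcases a with _ | a
    · obtain rfl : (z, (0, b)) = d := by simpa [next] using h
      exact .single (st 0 (by omega) (by simp [block, Instr.Rel, counter, flowConfig]))
    · obtain rfl : (l, (a, b)) = d := by simpa [next] using h
      exact .head (b := ![a + 1, b, addr i + 1])
        (st 0 (by omega) (by simp [block, Instr.Rel, counter, flowConfig]))
        (.head (b := ![a, b, addr i + 2])
          (st 1 (by omega) (by simp [block, Instr.Rel, counter]))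
          (.single (st 2 (by omega) (by simp [block, Instr.Rel, flowConfig]))))
  · rcases b with _ | b
    · obtain rfl : (z, (a, 0)) = d := by simpa [next] using h
      exact .single (st 0 (by omega) (by simp [block, Instr.Rel, counter, flowConfig]))
    · obtain rfl : (l, (a, b)) = d := by simpa [next] using h
      exact .head (b := ![a, b + 1, addr i + 1])
        (st 0 (by omega) (by simp [block, Instr.Rel, counter, flowConfig]))
        (.head (b := ![a, b, addr i + 2])
          (st 1 (by omega) (by simp [block, Instr.Rel, counter]))
          (.single (st 2 (by omega) (by simp [block, Instr.Rel, flowConfig]))))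
  · simp [next] at h

theorem transGen_stepRel_of_transGen_flowStep {n : ℕ} {δ : Fin n → FlowOp (Fin n)}
    {c d : Fin n × (ℕ × ℕ)} (h : TransGen (FlowStep δ) c d) :
    TransGen (stepRel (flowProgram δ)) (flowConfig c) (flowConfig d) := by
  induction h with
  | single h => exact h.transGen_stepRel
  | tail _ h ih => exact ih.trans h.transGen_stepRel

theorem reflTransGen_stepRel_of_reflTransGen_flowStep {n : ℕ} {δ : Fin n → FlowOp (Fin n)}
    {c d : Fin n × (ℕ × ℕ)} (h : ReflTransGen (FlowStep δ) c d) :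
    ReflTransGen (stepRel (flowProgram δ)) (flowConfig c) (flowConfig d) := by
  induction h with
  | refl => exact .refl
  | tail _ h ih => exact ih.trans h.transGen_stepRel.to_reflTransGen

/-! ### Determinism, halting and non-halting of the compiled programs -/

theorem Instr.Rel.right_unique {I : Instr} {i : ℕ} {y x x' : Config} (h : I.Rel i y x)
    (h' : I.Rel i y x') : x = x' := by
  ext k
  rcases I with j | j | ⟨j, z⟩ | z <;> (try fin_cases j) <;> fin_cases k <;>
    simp [Instr.Rel] at h h' ⊢ <;> omega

theorem Instr.Rel.pc {I : Instr} {i : ℕ} {y x : Config} (h : I.Rel i y x) : y 2 = i := by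
  cases I <;> exact h.2.2.1

theorem stepRel_rightUnique (P : Program) : Relator.RightUnique (stepRel P) := by
  rintro y x x' ⟨i, hi, h⟩ ⟨j, hj, h'⟩
  obtain rfl : i = j := by have := h.pc; have := h'.pc; omega
  exact h.right_unique h'

theorem not_stepRel_of_mem_halted {P : Program} {y x : Config} (hy : y ∈ halted P) :
    ¬ stepRel P y x := by
  rintro ⟨i, hi, h⟩
  exact hy (by rw [h.pc]; omega)

/-- Every point on the way keeps a nonempty path back into `S`. By determinism a step taken is the
first step of that path; if this exhausts it, the point reached lies in `S` and a new path starts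
there. -/
theorem exists_rel_of_reflTransGen {α : Type*} {r : α → α → Prop}
    (hr : Relator.RightUnique r) {S : Set α} (hS : ∀ a ∈ S, ∃ b ∈ S, TransGen r a b)
    {a b : α} (ha : a ∈ S) (hab : ReflTransGen r a b) : ∃ c, r b c := by
  have key : ∃ c ∈ S, TransGen r b c := by
    induction hab with
    | refl => exact hS a ha
    | tail _ h ih =>
      obtain ⟨c, hc, h'⟩ := ih
      obtain ⟨d, hd, h''⟩ := TransGen.head'_iff.1 h'
      obtain rfl := hr h hd
      rcases reflTransGen_iff_eq_or_transGen.1 h'' with rfl | h₃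
      · exact hS _ hc
      · exact ⟨c, hc, h₃⟩
  obtain ⟨c, -, h⟩ := key
  obtain ⟨d, hd, -⟩ := TransGen.head'_iff.1 h
  exact ⟨d, hd⟩

theorem halts_flowProgram {n : ℕ} {δ : Fin n → FlowOp (Fin n)} {c d : Fin n × (ℕ × ℕ)}
    (h : ReflTransGen (FlowStep δ) c d) (hd : δ d.1 = .halt) :
    Halts (flowProgram δ) {flowConfig c} (halted (flowProgram δ)) := by
  -- A halting node is compiled to a jump to address `0`, which holds no instruction. This step also
  -- ensures that at least one instruction is executed.
  refine ⟨_, rfl, ![d.2.1, d.2.2, 0], by simp [halted],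
    TransGen.trans_right (reflTransGen_stepRel_of_reflTransGen_flowStep h)
      (.single (stepRel_flowProgram δ d.1 0 (by omega) ?_))⟩
  simp [hd, block, Instr.Rel, flowConfig]

theorem not_halts_flowProgram {n : ℕ} {δ : Fin n → FlowOp (Fin n)} {S : Set (Fin n × (ℕ × ℕ))}
    (hS : ∀ a ∈ S, ∃ b ∈ S, TransGen (FlowStep δ) a b) {c d : Fin n × (ℕ × ℕ)} (hd : d ∈ S)
    (h : ReflTransGen (FlowStep δ) c d) :
    ¬ Halts (flowProgram δ) {flowConfig c} (halted (flowProgram δ)) := by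
  rintro ⟨_, rfl, f, hf, hcf⟩
  have hT : ∀ a ∈ flowConfig '' S, ∃ b ∈ flowConfig '' S,
      TransGen (stepRel (flowProgram δ)) a b := by
    rintro _ ⟨a, ha, rfl⟩
    obtain ⟨b, hb, hab⟩ := hS a ha
    exact ⟨_, ⟨b, hb, rfl⟩, transGen_stepRel_of_transGen_flowStep hab⟩
  -- Two configurations reached from the same one are comparable by determinism, and nothing follows
  -- the halted `f`.
  have hdf : ReflTransGen (stepRel (flowProgram δ)) (flowConfig d) f := by
    rcases ReflTransGen.total_of_right_unique (stepRel_rightUnique _)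
      (reflTransGen_stepRel_of_reflTransGen_flowStep h) hcf.to_reflTransGen with h' | h'
    · exact h'
    · rcases ReflTransGen.cases_head h' with h₀ | ⟨g, hg, -⟩
      · rw [h₀]
      · exact absurd hg (not_stepRel_of_mem_halted hf)
  obtain ⟨g, hg⟩ := exists_rel_of_reflTransGen (stepRel_rightUnique _) hT
    (Set.mem_image_of_mem _ hd) hdf
  exact not_stepRel_of_mem_halted hf hg

/-! ## Counter machines with arbitrarily many registers -/

namespace Frag

open Function

/-- The fragment that changes nothing. -/
def skip : Frag := (incr false).seq (decr false)

theorem runs_skip (a b : ℕ) : skip.Runs (a, b) (a, b) :=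
  (runs_incr_false a b).seq (runs_decr_false a b)

/-- The `n`-fold repetition of a fragment. -/
def iter (c : Frag) : ℕ → Frag
  | 0 => skip
  | n + 1 => c.seq (iter c n)

theorem runs_iter_incr_true (n a b : ℕ) : ((incr true).iter n).Runs (a, b) (a, b + n) := by
  induction n generalizing b with
  | zero => exact runs_skip a b
  | succ n ih =>
    have := (runs_incr_true a b).seq (ih (b + 1))
    rwa [show b + 1 + n = b + (n + 1) by omega] at this

theorem runs_iter_decr_false (n a b : ℕ) : ((decr false).iter n).Runs (a + n, b) (a, b) := by
  induction n with
  | zero => exact runs_skip a b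
  | succ n ih => exact (runs_decr_false (a + n) b).seq ih

theorem runs_loop_incr_false (a b : ℕ) : (loop true (incr false)).Runs (a, b) (a + b, 0) := by
  induction b generalizing a with
  | zero => exact runs_loop_true_zero _ _
  | succ b ih =>
    have := runs_loop_true_succ (runs_incr_false a b) (ih (a + 1))
    rwa [show a + 1 + b = a + (b + 1) by omega] at this

/-- Multiplication of the first counter by `p`. -/
def mul (p : ℕ) : Frag := (loop false ((incr true).iter p)).seq (loop true (incr false))

theorem runs_mul (p N : ℕ) : (mul p).Runs (N, 0) (N * p, 0) := by
  -- Generalized over the second counter, which accumulates `p` per round.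
  have key : ∀ a b, (loop false ((incr true).iter p)).Runs (a, b) (0, b + a * p) := by
    intro a
    induction a with
    | zero => intro b; simpa using runs_loop_false_zero _ b
    | succ a ih =>
      intro b
      have := runs_loop_false_succ (runs_iter_incr_true p a b) (ih (b + p))
      rwa [show b + p + a * p = b + (a + 1) * p by ring] at this
  simpa [mul] using (key N 0).seq (runs_loop_incr_false _ _)

/-- Exact division of the first counter by `p`. -/
def div (p : ℕ) : Frag :=
  (loop false (((decr false).iter (p - 1)).seq (incr true))).seq (loop true (incr false))

/-- The loop test itself takes one unit per round, so the body removes only `p - 1` more. -/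
theorem runs_div {p : ℕ} (hp : p ≠ 0) (N : ℕ) : (div p).Runs (N * p, 0) (N, 0) := by
  obtain ⟨k, rfl⟩ := Nat.exists_eq_succ_of_ne_zero hp
  have key : ∀ a b, (loop false (((decr false).iter k).seq (incr true))).Runs
      (a * (k + 1), b) (0, b + a) := by
    intro a
    induction a with
    | zero => intro b; simpa using runs_loop_false_zero _ b
    | succ a ih =>
      intro b
      have := runs_loop_false_succ
        ((runs_iter_decr_false k (a * (k + 1)) b).seq (runs_incr_true _ b)) (ih (b + 1))
      rwa [show b + 1 + a = b + (a + 1) by omega,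
        show a * (k + 1) + k + 1 = (a + 1) * (k + 1) by ring] at this
  simpa [div] using (key N 0).seq (runs_loop_incr_false _ _)

/-- The prime that encodes register `i`. -/
noncomputable def regPrime (i : ℕ) : ℕ := Nat.nth Nat.Prime i

theorem prime_regPrime (i : ℕ) : (regPrime i).Prime := Nat.prime_nth_prime i

instance (i : ℕ) : NeZero (regPrime i) := ⟨(prime_regPrime i).ne_zero⟩

theorem regPrime_injective : Injective regPrime := Nat.nth_injective Nat.infinite_setOfPred_prime

/-- `N` encodes the contents `σ` of the registers. -/
def Encodes (N : ℕ) (σ : ℕ → ℕ) : Prop := N ≠ 0 ∧ ∀ i, N.factorization (regPrime i) = σ i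

/-- Both directions are needed: one justifies increments by multiplication, the other decrements by
division. -/
theorem encodes_mul_iff {N : ℕ} {σ : ℕ → ℕ} (i : ℕ) :
    Encodes (N * regPrime i) (update σ i (σ i + 1)) ↔ Encodes N σ := by
  have hp := prime_regPrime i
  simp only [Encodes, ne_eq, mul_eq_zero, hp.ne_zero, or_false]
  refine and_congr_right fun hN => forall_congr' fun j => ?_
  rw [Nat.factorization_mul hN hp.ne_zero, Finsupp.add_apply, hp.factorization,
    Finsupp.single_apply]
  by_cases hj : j = i
  · subst hj; simp
  · rw [if_neg fun h => hj (regPrime_injective h.symm), update_of_ne hj, add_zero]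

theorem Encodes.dvd_iff {N : ℕ} {σ : ℕ → ℕ} (h : Encodes N σ) (i : ℕ) :
    regPrime i ∣ N ↔ σ i ≠ 0 := by
  rw [(prime_regPrime i).dvd_iff_one_le_factorization h.1, h.2, Nat.one_le_iff_ne_zero]

/-- Register `0` belongs to the prime `2`, so an input has the explicit, evidently computable
encoding `2 ^ n`. -/
theorem encodes_two_pow (n : ℕ) : Encodes (2 ^ n) (update 0 0 n) := by
  induction n with
  | zero => simp [Encodes]
  | succ n ih =>
    have h := (encodes_mul_iff 0).2 ih
    rwa [update_self, update_idem, regPrime, Nat.nth_prime_zero_eq_two, ← pow_succ] at h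

/-- On register contents `σ`, the fragment terminates with `τ`. -/
def Maps (c : Frag) (σ τ : ℕ → ℕ) : Prop :=
  ∀ N, Encodes N σ → ∃ M, Encodes M τ ∧ c.Runs (N, 0) (M, 0)

theorem Maps.congr {c : Frag} {σ σ' τ τ' : ℕ → ℕ} (h : c.Maps σ τ) (hσ : ∀ i, σ i = σ' i)
    (hτ : ∀ i, τ i = τ' i) : c.Maps σ' τ' :=
  funext hσ ▸ funext hτ ▸ h

theorem maps_skip (σ : ℕ → ℕ) : skip.Maps σ σ := fun N hN => ⟨N, hN, runs_skip N 0⟩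

theorem Maps.seq {c d : Frag} {σ τ υ : ℕ → ℕ} (hc : c.Maps σ τ) (hd : d.Maps τ υ) :
    (c.seq d).Maps σ υ := fun N hN =>
  have ⟨_, hM, h₁⟩ := hc N hN
  have ⟨K, hK, h₂⟩ := hd _ hM
  ⟨K, hK, h₁.seq h₂⟩

theorem maps_mul (i : ℕ) (σ : ℕ → ℕ) : (mul (regPrime i)).Maps σ (update σ i (σ i + 1)) :=
  fun N hN => ⟨_, (encodes_mul_iff i).2 hN, runs_mul _ N⟩

theorem maps_div (i : ℕ) {σ : ℕ → ℕ} (h : σ i ≠ 0) :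
    (div (regPrime i)).Maps σ (update σ i (σ i - 1)) := fun N hN => by
  obtain ⟨M, rfl⟩ := (hN.dvd_iff i).2 h
  rw [mul_comm] at hN ⊢
  refine ⟨M, (encodes_mul_iff i).1 ?_, runs_div (prime_regPrime i).ne_zero M⟩
  rwa [update_self, update_idem, Nat.sub_add_cancel (Nat.one_le_iff_ne_zero.2 h), update_eq_self]

/-- While the register is nonzero, execute `c`. -/
noncomputable def whileReg (i : ℕ) (c : Frag) : Frag := loopDvd (regPrime i) c

theorem maps_whileReg_of_eq {i : ℕ} (c : Frag) {σ : ℕ → ℕ} (h : σ i = 0) :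
    (whileReg i c).Maps σ σ := fun N hN =>
  ⟨N, hN, runs_loopDvd_of_not_dvd c (by simp [hN.dvd_iff, h])⟩

theorem maps_whileReg_of_ne {i : ℕ} {c : Frag} {σ τ υ : ℕ → ℕ} (h : σ i ≠ 0) (hc : c.Maps σ τ)
    (hw : (whileReg i c).Maps τ υ) : (whileReg i c).Maps σ υ := fun N hN => by
  obtain ⟨M, hM, h₁⟩ := hc N hN
  obtain ⟨K, hK, h₂⟩ := hw M hM
  exact ⟨K, hK, runs_loopDvd_of_dvd ((hN.dvd_iff i).2 h) h₁ h₂⟩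

/-- While the register is nonzero, decrement it and execute `c`. -/
noncomputable def forReg (i : ℕ) (c : Frag) : Frag := whileReg i ((div (regPrime i)).seq c)

/-- The family `I` is the loop invariant: `I m` describes the registers when `m` rounds remain. The
body starts from `I (m + 1)` with register `i` already decremented. -/
theorem maps_forReg {i : ℕ} {c : Frag} (I : ℕ → ℕ → ℕ) (n : ℕ) (hI : ∀ m ≤ n, I m i = m)
    (hc : ∀ m < n, c.Maps (update (I (m + 1)) i m) (I m)) : (forReg i c).Maps (I n) (I 0) := by
  induction n with
  | zero => exact maps_whileReg_of_eq _ (hI 0 le_rfl)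
  | succ n ih =>
    have h₁ := hI (n + 1) le_rfl
    refine maps_whileReg_of_ne (by omega) ((maps_div i (by omega)).seq ?_)
      (ih (fun m hm => hI m (by omega)) fun m hm => hc m (by omega))
    rw [h₁]
    exact hc n (by omega)

/-- Reset a register. -/
noncomputable def clear (i : ℕ) : Frag := forReg i skip

theorem maps_clear (i : ℕ) (σ : ℕ → ℕ) : (clear i).Maps σ (update σ i 0) := by
  have := maps_forReg (i := i) (c := skip) (fun m => update σ i m) (σ i) (by simp)
    (fun m _ => by simpa using maps_skip _)
  simpa [clear] using this

/-- Add register `i` to register `j`, and reset it. -/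
noncomputable def move (i j : ℕ) : Frag := forReg i (mul (regPrime j))

theorem maps_move {i j : ℕ} (h : i ≠ j) (σ : ℕ → ℕ) :
    (move i j).Maps σ (update (update σ j (σ j + σ i)) i 0) := by
  have := maps_forReg (i := i) (c := mul (regPrime j))
    -- With `m` rounds left, `σ i - m` units have been transferred.
    (fun m => update (update σ j (σ j + (σ i - m))) i m) (σ i) (by simp) (fun m hm => by
      refine (maps_mul j _).congr (fun _ => rfl) fun k => ?_
      simp only [update_apply]
      grind)
  refine this.congr (fun k => ?_) fun k => ?_ <;>
  · simp only [update_apply]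
    grind

/-- Add register `i` to register `j`, by means of the register `t`. -/
noncomputable def copy (i j t : ℕ) : Frag :=
  (forReg i ((mul (regPrime j)).seq (mul (regPrime t)))).seq (move t i)

/-- Emptying register `i` feeds both `j` and `t`; moving `t` back restores `i`. Since `t` starts at
zero, it ends at zero. -/
theorem maps_copy {i j t : ℕ} (hij : i ≠ j) (hit : i ≠ t) (hjt : j ≠ t) {σ : ℕ → ℕ}
    (ht : σ t = 0) : (copy i j t).Maps σ (update σ j (σ j + σ i)) := by
  have := maps_forReg (i := i) (c := (mul (regPrime j)).seq (mul (regPrime t)))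
    (fun m => update (update (update σ j (σ j + (σ i - m))) t (σ i - m)) i m) (σ i) (by simp)
    (fun m hm => by
      refine ((maps_mul j _).seq (maps_mul t _)).congr (fun _ => rfl) fun k => ?_
      simp only [update_apply]
      grind)
  refine (this.seq (maps_move hit.symm _)).congr (fun k => ?_) fun k => ?_ <;>
  · simp only [update_apply]
    grind

end Frag

/-! ### Computing primitive recursive functions -/

namespace Frag

open Function

/-- Fragments that fill the registers `k, …, k + n - 1` one after the other. -/
theorem exists_frag_fill (k n : ℕ) (Z : (ℕ → ℕ) → Prop) (v : (ℕ → ℕ) → ℕ → ℕ)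
    (h : ∀ i < n, ∃ c : Frag, ∀ σ, Z σ →
      c.Maps (fun x => if k ≤ x ∧ x < k + i then v σ (x - k) else σ x)
        (fun x => if k ≤ x ∧ x < k + (i + 1) then v σ (x - k) else σ x)) :
    ∃ c : Frag, ∀ σ, Z σ → c.Maps σ (fun x => if k ≤ x ∧ x < k + n then v σ (x - k) else σ x) := by
  induction n with
  | zero => exact ⟨skip, fun σ _ => (maps_skip σ).congr (fun _ => rfl) fun x => by grind⟩
  | succ n ih =>
    obtain ⟨c, hc⟩ := ih fun i hi => h i (by omega)
    obtain ⟨d, hd⟩ := h n (by omega)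
    exact ⟨c.seq d, fun σ hσ => (hc σ hσ).seq (hd σ hσ)⟩

theorem exists_frag_clear (k n : ℕ) :
    ∃ c : Frag, ∀ σ, c.Maps σ (fun x => if k ≤ x ∧ x < k + n then 0 else σ x) := by
  obtain ⟨c, hc⟩ := exists_frag_fill k n (fun _ => True) (fun _ _ => 0) fun i _ =>
    ⟨clear (k + i), fun σ _ => (maps_clear _ _).congr (fun _ => rfl) fun x => by
      simp only [update_apply]; grind⟩
  exact ⟨c, fun σ => hc σ trivial⟩

/-- Primitive recursive functions are computed by fragments: the arguments are read from the
registers `ins`, the value is written to the register `out`, and the registers from `k` on are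
scratch space. -/
theorem exists_frag_of_primrec {n : ℕ} {f : List.Vector ℕ n → ℕ} (hf : Nat.Primrec' f)
    (ins : Fin n → ℕ) (out k : ℕ) (hins : ∀ i, ins i < k ∧ ins i ≠ out) (hout : out < k) :
    ∃ c : Frag, ∀ σ : ℕ → ℕ, σ out = 0 → (∀ j ≥ k, σ j = 0) →
      c.Maps σ (update σ out (f (List.Vector.ofFn fun i => σ (ins i)))) := by
  induction hf generalizing out k with
  | zero => exact ⟨skip, fun σ h _ => (maps_skip σ).congr (fun _ => rfl) (by simp [← h])⟩
  | succ =>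
    have h₀ := hins 0
    refine ⟨(copy (ins 0) out k).seq (mul (regPrime out)), fun σ h hk =>
      ((maps_copy h₀.2 h₀.1.ne hout.ne (hk k le_rfl)).seq (maps_mul _ _)).congr
        (fun _ => rfl) fun x => ?_⟩
    simp [h]
  | get i =>
    have h₀ := hins i
    refine ⟨copy (ins i) out k, fun σ h hk =>
      (maps_copy h₀.2 h₀.1.ne hout.ne (hk k le_rfl)).congr (fun _ => rfl) fun x => ?_⟩
    simp [h]
  | @comp m n f g _ _ ihf ihg =>
    -- The values of the inner functions occupy the registers `k, …, k + n - 1`. Scratch space for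
    -- all parts starts at `k + n`, and the block is cleared at the end.
    obtain ⟨c₁, h₁⟩ := exists_frag_fill k n (fun σ => ∀ j ≥ k, σ j = 0)
      (fun σ i => if h : i < n then g ⟨i, h⟩ (List.Vector.ofFn fun j => σ (ins j)) else 0) (by
        intro i hi
        obtain ⟨c, hc⟩ := ihg ⟨i, hi⟩ ins (k + i) (k + n)
          (fun j => by have := hins j; omega) (by omega)
        refine ⟨c, fun σ hσ => (hc _ ?_ ?_).congr (fun _ => rfl) fun x => ?_⟩
        · simp [hσ]
        · intro j hj
          rw [if_neg (by omega)]
          exact hσ j (by omega)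
        · have h : ∀ j, ¬ (k ≤ ins j ∧ ins j < k + i) := fun j => by have := hins j; omega
          simp only [h, if_false, update_apply]
          by_cases hx : x = k + i
          · subst hx
            simp [hi]
          · grind)
    obtain ⟨c₂, h₂⟩ := ihf (fun i => k + i) out (k + n) (fun i => by omega) (by omega)
    obtain ⟨c₃, h₃⟩ := exists_frag_clear k n
    refine ⟨(c₁.seq c₂).seq c₃, fun σ h hk => (((h₁ σ hk).seq (h₂ _ ?_ ?_)).seq (h₃ _)).congr
      (fun _ => rfl) fun x => ?_⟩
    · rwa [if_neg (by omega)]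
    · intro j hj
      rw [if_neg (by omega)]
      exact hk j (by omega)
    · simp [update_apply]
      grind
  | @prec n f g _ _ ihf ihg =>
    obtain ⟨F, hF⟩ := ihf (fun i => ins i.succ) out k (fun i => hins _) hout
    -- Register `k` holds the current recursion argument, `out` the current value, `k + 1` the next
    -- value, and `k + 2` the number of remaining rounds. The last is a copy, since the input must
    -- survive.
    obtain ⟨G, hG⟩ := ihg (Fin.cons k (Fin.cons out fun i => ins i.succ)) (k + 1) (k + 3)
      (fun i => by
        refine Fin.cases ?_ (fun i => Fin.cases ?_ (fun i => ?_) i) i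
        · simp
        · simp; omega
        · have := hins i.succ
          simp; omega) (by omega)
    have h₀ := hins 0
    refine ⟨(((F.seq (copy (ins 0) (k + 2) (k + 1))).seq (forReg (k + 2)
      (((G.seq (clear out)).seq (move (k + 1) out)).seq (mul (regPrime k))))).seq (clear k)),
      fun σ h hk => ?_⟩
    set w := List.Vector.ofFn fun i : Fin n => σ (ins i.succ) with hw
    set R : ℕ → ℕ := fun y => y.rec (f w) fun y IH => g (y ::ᵥ IH ::ᵥ w) with hR
    set N := σ (ins 0) with hN
    -- With `m` rounds left, the recursion has reached argument `N - m`.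
    let I : ℕ → ℕ → ℕ := fun m => update (update (update σ out (R (N - m))) k (N - m)) (k + 2) m
    have hI : (forReg (k + 2) (((G.seq (clear out)).seq (move (k + 1) out)).seq
        (mul (regPrime k)))).Maps (I N) (I 0) := by
      refine maps_forReg I N (fun m _ => by simp [I]) fun m hm => ?_
      refine ((((hG _ ?_ ?_).seq (maps_clear _ _)).seq
        (maps_move (by omega) _)).seq (maps_mul _ _)).congr (fun _ => rfl) fun x => ?_
      · simp only [I, update_apply]
        have := hk (k + 1) (by omega)
        grind
      · intro j hj
        simp only [I, update_apply]
        have := hk j (by omega)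
        grind
      · have hv : (List.Vector.ofFn fun i => update (I (m + 1)) (k + 2) m
            ((Fin.cons k (Fin.cons out fun i => ins i.succ) : Fin (n + 2) → ℕ) i)) =
            (N - (m + 1)) ::ᵥ R (N - (m + 1)) ::ᵥ w := by
          have h₁ : ∀ i : Fin n, ins i.succ ≠ out ∧ ins i.succ ≠ k ∧ ins i.succ ≠ k + 2 :=
            fun i => by have := hins i.succ; omega
          have h₂ : out ≠ k ∧ out ≠ k + 2 := by omega
          simp only [List.Vector.ofFn, Fin.cons_zero, Fin.cons_succ, I, hw, update_apply, h₁, h₂,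
            if_true, if_false, show k ≠ k + 2 by omega]
        have hs : R (N - m) = g ((N - (m + 1)) ::ᵥ R (N - (m + 1)) ::ᵥ w) := by
          rw [show N - m = (N - (m + 1)) + 1 by omega]
        rw [hv, ← hs]
        simp only [I, update_apply]
        have := hk (k + 1) (by omega)
        grind
    refine ((((hF σ h hk).seq (maps_copy ?_ ?_ ?_ ?_)).seq (hI.congr (fun x => ?_) fun _ =>
      rfl)).seq (maps_clear _ _)).congr (fun _ => rfl) fun x => ?_
    · omega
    · omega
    · omega
    · rw [update_of_ne (by omega)]
      exact hk _ (by omega)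
    · simp only [I, update_apply]
      have := hk (k + 2) (by omega)
      have := hk k (by omega)
      have : R 0 = f w := rfl
      grind
    · change update (I 0) k 0 x = update σ out (R N) x
      simp only [I, update_apply]
      have := hk (k + 2) (by omega)
      have := hk k (by omega)
      grind

end Frag

/-! ### Unbounded search and an undecidable halting problem -/

open Frag Function Relation

/-- Unbounded search for a zero of a primitive recursive function by a two-counter machine. -/
theorem exists_program_search {g : List.Vector ℕ 2 → ℕ} (hg : Nat.Primrec' g) :
    ∃ (P : Program) (q : ℕ), ∀ n : ℕ,
      Halts P {![2 ^ n, 0, q]} (halted P) ↔ ∃ t, g (n ::ᵥ t ::ᵥ .nil) = 0 := by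
  obtain ⟨G, hG⟩ := exists_frag_of_primrec hg (fun i => i) 2 3 (fun i => by omega) (by omega)
  let B : Frag := ((clear 2).seq (mul (regPrime 1))).seq G
  obtain ⟨m, δ, e, x, he, hx⟩ := (G.seq (whileReg 2 B)).exists_fin_embeds
  refine ⟨flowProgram δ, FlowOp.addr (e (G.seq (whileReg 2 B)).entry), fun n => ?_⟩
  change Halts _ {flowConfig (e (G.seq (whileReg 2 B)).entry, (2 ^ n, 0))} _ ↔ _
  -- The registers at the loop test: input in `0`, candidate `t` in `1`, value of `g` in `2`. The
  -- loop continues while the value is nonzero.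
  let τ : ℕ → ℕ → ℕ := fun t =>
    update (update (update 0 0 n) 1 t) 2 (g (n ::ᵥ t ::ᵥ .nil))
  have hGτ : ∀ t, G.Maps (update (update 0 0 n) 1 t) (τ t) := fun t => by
    refine (hG _ (by simp) fun j hj => ?_).congr (fun _ => rfl) fun j => ?_
    · simp only [update_apply, Pi.zero_apply]
      grind
    · simp [τ, List.Vector.ofFn]
  have hBτ : ∀ t, B.Maps (τ t) (τ (t + 1)) := fun t => by
    refine ((maps_clear _ _).seq (maps_mul _ _)).seq ((hGτ (t + 1)).congr (fun j => ?_)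
      fun _ => rfl)
    simp only [τ, update_apply, Pi.zero_apply]
    grind
  have hstart : Encodes (2 ^ n) (update (update 0 0 n) 1 0) := by
    convert encodes_two_pow n using 1
    exact update_eq_self _ _
  constructor
  · intro hh
    by_contra! hne
    let e' : (whileReg 2 B).Lab → Fin m := fun l => e (.inr l)
    have he' : (whileReg 2 B).Embeds δ e' x := fun l => he (.inr l)
    obtain ⟨N, hN, hr⟩ := hGτ 0 _ hstart
    -- Without a zero of `g`, every visit to the loop entry is followed by another one with the next
    -- candidate.
    refine not_halts_flowProgram
      (S := {c | ∃ t N, Encodes N (τ t) ∧ c = (e' (whileReg 2 B).entry, (N, 0))}) ?_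
      ⟨0, N, hN, rfl⟩ (hr _ δ (fun l => e (.inl l)) _ fun l => he (.inl l)) hh
    rintro _ ⟨t, N, hN, rfl⟩
    obtain ⟨M, hM, hr⟩ := hBτ t N hN
    exact ⟨_, ⟨t + 1, M, hM, rfl⟩, loopDvd_body he' ((hN.dvd_iff 2).2 (by simpa [τ] using hne t)) hr⟩
  · rintro ⟨t, ht⟩
    -- Induction on the distance `d` to a known zero. The loop may stop earlier, so the final
    -- contents `υ` are left unspecified.
    have key : ∀ d s, g (n ::ᵥ (s + d) ::ᵥ .nil) = 0 → ∃ υ, (whileReg 2 B).Maps (τ s) υ := by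
      intro d
      induction d with
      | zero => exact fun s hs => ⟨_, maps_whileReg_of_eq _ (by simpa [τ] using hs)⟩
      | succ d ih =>
        intro s hs
        by_cases h₀ : τ s 2 = 0
        · exact ⟨_, maps_whileReg_of_eq _ h₀⟩
        · obtain ⟨υ, hυ⟩ := ih (s + 1) (by rwa [show s + 1 + d = s + (d + 1) by omega])
          exact ⟨υ, maps_whileReg_of_ne h₀ (hBτ s) hυ⟩
    obtain ⟨υ, hυ⟩ := key t 0 (by rwa [zero_add])
    obtain ⟨M, -, hM⟩ := ((hGτ 0).seq hυ) _ hstart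
    exact halts_flowProgram (hM _ δ e x he) hx

open Nat.Partrec (Code) in
/-- A fixed program with an undecidable halting problem. -/
theorem exists_universal_program : ∃ (P : Program) (q : ℕ), ∀ c : Code,
    Halts P {![2 ^ Encodable.encode c, 0, q]} (halted P) ↔ (c.eval 0).Dom := by
  -- The first entry is a code, the second a bound for `evaln`; the value is zero when evaluation at
  -- `0` succeeds within that bound.
  have hg : Primrec fun v : List.Vector ℕ 2 =>
      if (Code.evaln v.tail.head (Denumerable.ofNat Code v.head) 0).isSome then 0 else 1 := by
    have h₁ : Primrec fun v : List.Vector ℕ 2 =>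
        (Code.evaln v.tail.head (Denumerable.ofNat Code v.head) 0).isSome :=
      Primrec.option_isSome.comp (Code.primrec_evaln.comp
        (((Primrec.vector_head.comp Primrec.vector_tail).pair
          ((Primrec.ofNat Code).comp Primrec.vector_head)).pair (Primrec.const 0)))
    exact Primrec.ite (Primrec.eq.comp h₁ (Primrec.const true)) (Primrec.const 0)
      (Primrec.const 1)
  obtain ⟨P, q, hP⟩ := exists_program_search (Nat.Primrec'.of_prim hg)
  refine ⟨P, q, fun c => ?_⟩
  rw [hP]
  simp only [List.Vector.head_cons, List.Vector.tail_cons, Denumerable.ofNat_encode,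
    ite_eq_left_iff, one_ne_zero, imp_false, not_not, Option.isSome_iff_exists, Part.dom_iff_mem,
    Code.evaln_complete, Option.mem_def]
  exact exists_comm

theorem primrec_pi_fin {α σ : Type*} [Primcodable α] [Primcodable σ] {n : ℕ} {f : α → Fin n → σ}
    (hf : ∀ i, Primrec fun a => f a i) : Primrec f :=
  Primrec.fin_curry.2 (Primrec.fin_curry₁ (f := fun i a => f a i) |>.2 hf).swap

theorem primrec_pow : Primrec₂ fun m n : ℕ => m ^ n := Primrec₂.unpaired'.1 Nat.Primrec.pow

/-- The initial configurations of the universal program are computable from the codes. -/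
theorem computable_codeConfig (q : ℕ) : Computable fun c : Nat.Partrec.Code =>
    (![2 ^ Encodable.encode c, 0, q] : Config) := by
  refine (primrec_pi_fin fun i => ?_).to_comp
  fin_cases i
  · exact primrec_pow.comp (Primrec.const 2) Primrec.encode
  · exact Primrec.const 0
  · exact Primrec.const q

/-- There is a fixed program whose halting problem is undecidable, in the sense that no computable
function decides it. -/
theorem exists_program_halts_undecidable : ∃ P : Program,
    ¬ ∃ f : Config → Bool, Computable f ∧ ∀ a, f a = true ↔ ¬ Halts P {a} (halted P) := by
  obtain ⟨P, q, hP⟩ := exists_universal_program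
  refine ⟨P, fun ⟨f, hf, h⟩ => ComputablePred.halting_problem 0 ?_⟩
  refine ComputablePred.computable_iff.2 ⟨fun c => !f ![2 ^ Encodable.encode c, 0, q],
    Primrec.not.to_comp.comp (hf.comp (computable_codeConfig q)), funext fun c => ?_⟩
  rw [← hP c, eq_iff_iff, Bool.not_eq_true', Bool.eq_false_iff, ne_eq, h, not_not]

/-! ## The automata built from a program -/

namespace EFA

open Relation

variable {P : Program} {ini fin : Set Config} {E : EFA ℕ ℕ Config Config}

theorem step_of_mem {q σ q' : ℕ} {φ : Config → Config → Prop} {ξ : Config → Config → Config}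
    (hr : trans1 q σ φ ξ q' ∈ E.trans) {y x : Config} (h : φ y x) :
    E.Step (q, y) (σ, [x]) (q', ξ y x) :=
  ⟨_, hr, fun _ => x, rfl, rfl, h, rfl⟩

/-- All transitions of `E` have step-length `1`. -/
def UnitLength (E : EFA ℕ ℕ Config Config) : Prop :=
  ∀ r ∈ E.trans, ∃ q σ φ ξ q', r = trans1 q σ φ ξ q'

theorem UnitLength.step_iff (hE : E.UnitLength) {s t : ℕ × Config} {v : ℕ × List Config} :
    E.Step s v t ↔ ∃ q σ φ ξ q' y x, trans1 q σ φ ξ q' ∈ E.trans ∧ φ y x ∧ s = (q, y) ∧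
      v = (σ, [x]) ∧ t = (q', ξ y x) := by
  constructor
  · rintro ⟨r, hr, a, h₁, h₂, h₃, h₄⟩
    obtain ⟨q, σ, φ, ξ, q', rfl⟩ := hE r hr
    change Fin 1 → Config at a
    exact ⟨q, σ, φ, ξ, q', s.2, a 0, hr, h₃, Prod.ext h₁ rfl, h₂, h₄⟩
  · rintro ⟨q, σ, φ, ξ, q', y, x, hr, h, rfl, rfl, rfl⟩
    exact step_of_mem hr h

theorem unitLength_hatE : (hatE P ini fin).UnitLength := by
  rintro r ((rfl | rfl | rfl | rfl | rfl | rfl | rfl) | rfl) <;> exact ⟨_, _, _, _, _, rfl⟩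

/-- From the state `s`, the automaton can read the parameters `w`. -/
def Reads (E : EFA ℕ ℕ Config Config) (s : ℕ × Config) (w : List Config) : Prop :=
  ∃ u t, E.Path s u t ∧ u.map Prod.snd = w.map fun a => [a]

theorem reads_nil (s : ℕ × Config) : E.Reads s [] := ⟨[], s, .nil s, rfl⟩

theorem reads_cons {s : ℕ × Config} {x : Config} {w : List Config} :
    E.Reads s (x :: w) ↔ ∃ σ t, E.Step s (σ, [x]) t ∧ E.Reads t w := by
  constructor
  · rintro ⟨u, r, h, hu⟩
    cases h with
    | nil => simp at hu
    | @cons _ t _ v u hst htr =>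
      simp only [List.map_cons, List.cons.injEq] at hu
      obtain ⟨σ, l⟩ := v
      obtain ⟨rfl, hu⟩ := hu
      exact ⟨σ, t, hst, u, r, htr, hu⟩
  · rintro ⟨σ, t, h, u, r, hu, hw⟩
    exact ⟨(σ, [x]) :: u, r, .cons h hu, by simp [hw]⟩

theorem Reads.cons_of_mem {q σ q' : ℕ} {φ : Config → Config → Prop}
    {ξ : Config → Config → Config} {y x : Config} {w : List Config}
    (hr : trans1 q σ φ ξ q' ∈ E.trans) (h : φ y x) (hw : E.Reads (q', ξ y x) w) :
    E.Reads (q, y) (x :: w) :=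
  reads_cons.2 ⟨σ, _, step_of_mem hr h, hw⟩

theorem Reads.exists_of_cons {q : ℕ} {y x : Config} {w : List Config}
    (h : E.Reads (q, y) (x :: w)) : ∃ r ∈ E.trans, q = r.src ∧ (y, fun _ => x) ∈ r.guard ∧
      E.Reads (r.tgt, r.upd y fun _ => x) w := by
  obtain ⟨σ, t, ⟨r, hr, a, h₁, h₂, h₃, rfl⟩, hw⟩ := reads_cons.1 h
  obtain rfl : a = fun _ => x := funext fun i => by
    have h₂ : [x] = List.ofFn a := congrArg Prod.snd h₂
    exact List.mem_singleton.1 (h₂ ▸ List.mem_ofFn.2 ⟨i, rfl⟩)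
  exact ⟨r, hr, h₁, h₃, hw⟩

theorem UnitLength.exists_map_eq (hE : E.UnitLength) {s t : ℕ × Config}
    {u : List (ℕ × List Config)} (h : E.Path s u t) :
    ∃ w : List Config, u.map Prod.snd = w.map fun a => [a] := by
  induction h with
  | nil => exact ⟨[], rfl⟩
  | cons h _ ih =>
    obtain ⟨w, hw⟩ := ih
    obtain ⟨_, _, _, _, _, _, x, _, _, _, rfl, _⟩ := hE.step_iff.1 h
    exact ⟨x :: w, by simp [hw]⟩

theorem observe_dataString_of_map_eq {u : List (ℕ × List Config)} {w : List Config}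
    (h : u.map Prod.snd = w.map fun a => [a]) :
    observe Set.univ (dataString u) = w.map fun a => [a] := by
  have h₁ : dataString u = w.map fun a => [a] := by
    rw [dataString, h, List.filter_eq_self]
    simp
  rw [h₁, observe]
  simp [List.map_map, Function.comp_def, List.filter_eq_self]

theorem path_states {s t : ℕ × Config}
    {u : List (ℕ × List Config)} (h : E.Path s u t) (hs : s.1 ∈ E.states) : t.1 ∈ E.states := by
  induction h with
  | nil => exact hs
  | cons h _ ih =>
    obtain ⟨r, hr, _, _, _, _, rfl⟩ := h
    exact ih (E.trans_mem r hr).2.2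

theorem UnitLength.observationsFrom_singleton (hE : E.UnitLength) {q : ℕ} (hq : q ∈ E.start) :
    E.observationsFrom {q} Set.univ =
      (fun w : List Config => w.map fun a => [a]) '' {w | ∃ y ∈ E.Y0, E.Reads (q, y) w} := by
  ext d
  constructor
  · rintro ⟨u, ⟨q₁, hq₁, q₂, -, b₁, b₂, h, hb⟩, rfl⟩
    obtain rfl := Finset.mem_singleton.1 hq₁
    obtain ⟨w, hw⟩ := hE.exists_map_eq h
    exact ⟨w, ⟨b₁, hb hq, u, _, h, hw⟩, (observe_dataString_of_map_eq hw).symm⟩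
  · rintro ⟨w, ⟨y, hy, u, t, h, hw⟩, rfl⟩
    exact ⟨u, ⟨q, Finset.mem_singleton_self q, t.1, path_states h (E.start_subset hq), y, t.2,
      h, fun _ => hy⟩, (observe_dataString_of_map_eq hw).symm⟩

theorem UnitLength.observationsFrom_eq_allStrings_iff (hE : E.UnitLength) {q : ℕ}
    (hq : q ∈ E.start) : E.observationsFrom {q} Set.univ = allStrings Config ↔
      ∀ w, ∃ y ∈ E.Y0, E.Reads (q, y) w := by
  have hinj : Function.Injective fun w : List Config => w.map fun a => [a] :=
    List.map_injective_iff.2 fun a b h => by simpa using h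
  rw [hE.observationsFrom_singleton hq, allStrings, ← Set.image_univ,
    hinj.image_injective.eq_iff, Set.eq_univ_iff_forall]
  rfl

theorem initialStateOpaque_iff_subset {Qs Qns : Finset ℕ} {vis : Set Config} :
    E.InitialStateOpaque Qs Qns vis ↔
      E.observationsFrom Qs vis ⊆ E.observationsFrom Qns vis := by
  constructor
  · rintro h _ ⟨u, hu, rfl⟩
    exact h u hu
  · exact fun h u hu => h ⟨u, hu, rfl⟩

/-- All observations from `q'` are sequences of `1`-tuples, so containing all such sequences is the
same as equality. -/
theorem UnitLength.initialStateOpaque_iff (hE : E.UnitLength) {q q' : ℕ} (hq' : q' ∈ E.start)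
    (h : E.observationsFrom {q} Set.univ = allStrings Config) :
    E.InitialStateOpaque {q} {q'} Set.univ ↔
      E.observationsFrom {q'} Set.univ = allStrings Config := by
  rw [initialStateOpaque_iff_subset, h]
  refine ⟨fun h' => subset_antisymm ?_ h', fun h' => h'.symm.subset⟩
  rw [hE.observationsFrom_singleton hq']
  exact Set.image_subset_range _ _

/-! ### Strings readable in `hatE` -/

theorem hatE_reads_four (y : Config) (w : List Config) : (hatE P ini fin).Reads (4, y) w := by
  induction w with
  | nil => exact reads_nil _
  | cons x w ih =>
    exact ih.cons_of_mem (σ := 5) (φ := fun _ _ => True) (ξ := updNone) (Or.inr rfl) trivial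

theorem hatE_reads_three (y : Config) (w : List Config) : (hatE P ini fin).Reads (3, y) w := by
  induction w with
  | nil => exact reads_nil _
  | cons x w ih =>
    exact ih.cons_of_mem (σ := 4) (φ := fun _ _ => True) (ξ := updNone)
      (by simp [hatE, commonTrans]) trivial

/-- An incorrect letter leads to `q₃`, where everything is readable. Only a correct letter imposes a
condition on the rest, hence the implication here and for `q₁` and `q₂`. -/
theorem hatE_reads_zero {y x : Config} {w : List Config} :
    (hatE P ini fin).Reads (0, y) (x :: w) ↔ (x ∈ ini → (hatE P ini fin).Reads (1, x) w) := by
  constructor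
  · intro h hx
    obtain ⟨r, hr, h₁, h₃, h₄⟩ := h.exists_of_cons
    rcases hr with (rfl | rfl | rfl | rfl | rfl | rfl | rfl) | rfl <;>
      simp only [trans1, OfNat.zero_ne_ofNat, zero_ne_one] at h₁
    · exact h₄
    · exact absurd hx h₃
  · intro h
    by_cases hx : x ∈ ini
    · exact (h hx).cons_of_mem (σ := 1) (φ := fun _ x => x ∈ ini) (ξ := updStore)
        (by simp [hatE, commonTrans]) hx
    · exact (hatE_reads_three y w).cons_of_mem (σ := 1) (φ := fun _ x => x ∉ ini) (ξ := updNone)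
        (by simp [hatE, commonTrans]) hx

theorem hatE_reads_one {y x : Config} {w : List Config} :
    (hatE P ini fin).Reads (1, y) (x :: w) ↔
      (stepRel P y x → (hatE P ini fin).Reads (2, x) w) := by
  constructor
  · intro h hx
    obtain ⟨r, hr, h₁, h₃, h₄⟩ := h.exists_of_cons
    rcases hr with (rfl | rfl | rfl | rfl | rfl | rfl | rfl) | rfl <;>
      simp only [trans1, OfNat.one_ne_ofNat, one_ne_zero] at h₁
    · exact h₄
    · exact absurd hx h₃
  · intro h
    by_cases hx : stepRel P y x
    · exact (h hx).cons_of_mem (σ := 2) (φ := fun y x => stepRel P y x) (ξ := updStore)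
        (by simp [hatE, commonTrans]) hx
    · exact (hatE_reads_three y w).cons_of_mem (σ := 2) (φ := fun y x => ¬ stepRel P y x)
        (ξ := updNone) (by simp [hatE, commonTrans]) hx

theorem hatE_reads_two {y x : Config} {w : List Config} :
    (hatE P ini fin).Reads (2, y) (x :: w) ↔
      (x = y → x ∉ fin ∧ (hatE P ini fin).Reads (1, x) w) := by
  constructor
  · intro h hx
    obtain ⟨r, hr, h₁, h₃, h₄⟩ := h.exists_of_cons
    rcases hr with (rfl | rfl | rfl | rfl | rfl | rfl | rfl) | rfl <;>
      simp only [trans1, OfNat.ofNat_ne_one, OfNat.ofNat_ne_zero, Nat.reduceEqDiff] at h₁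
    · exact ⟨h₃.1, h₄⟩
    · exact absurd hx h₃
  · intro h
    by_cases hx : x = y
    · exact (h hx).2.cons_of_mem (σ := 3) (φ := fun y x => x ∉ fin ∧ x = y) (ξ := updStore)
        (by simp [hatE, commonTrans]) ⟨(h hx).1, hx⟩
    · exact (hatE_reads_three y w).cons_of_mem (σ := 3) (φ := fun y x => x ≠ y)
        (ξ := updNone) (by simp [hatE, commonTrans]) hx

/-- The unreadable word lists the run from `y` to `d` with every configuration after `y` doubled. It
never deviates, so it cannot escape to `q₃`, and the second `d` is refused because it is final. -/
theorem exists_not_hatE_reads_one {y d : Config} (h : TransGen (stepRel P) y d) (hd : d ∈ fin) :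
    ∃ w, ¬ (hatE P ini fin).Reads (1, y) w := by
  induction h using TransGen.head_induction_on with
  | single h =>
    refine ⟨[d, d], fun hw => ?_⟩
    exact (hatE_reads_two.1 (hatE_reads_one.1 hw h) rfl).1 hd
  | @head y z h _ ih =>
    obtain ⟨w, hw⟩ := ih
    exact ⟨z :: z :: w, fun hw' => hw (hatE_reads_two.1 (hatE_reads_one.1 hw' h) rfl).2⟩

/-- The states `q₁` and `q₂` alternate, so both claims go through one induction on the word. At `q₂`
at least one instruction has been executed, so a final configuration would contradict `hP`. -/
theorem hatE_reads_one_two (hP : ¬ Halts P ini fin) {c : Config} (hc : c ∈ ini)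
    (w : List Config) :
    (∀ y, ReflTransGen (stepRel P) c y → (hatE P ini fin).Reads (1, y) w) ∧
      ∀ y, TransGen (stepRel P) c y → (hatE P ini fin).Reads (2, y) w := by
  induction w with
  | nil => exact ⟨fun _ _ => reads_nil _, fun _ _ => reads_nil _⟩
  | cons x w ih =>
    refine ⟨fun y hy => hatE_reads_one.2 fun h => ih.2 x (TransGen.tail' hy h),
      fun y hy => hatE_reads_two.2 ?_⟩
    rintro rfl
    exact ⟨fun hx => hP ⟨c, hc, x, hx, hy⟩, ih.1 x hy.to_reflTransGen⟩

theorem observationsFrom_hatE_zero_iff (hini : ini.Nonempty) :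
    (hatE P ini fin).observationsFrom {0} Set.univ = allStrings Config ↔ ¬ Halts P ini fin := by
  rw [unitLength_hatE.observationsFrom_eq_allStrings_iff (by simp [hatE])]
  constructor
  · rintro h ⟨c, hc, d, hd, hcd⟩
    obtain ⟨w, hw⟩ := exists_not_hatE_reads_one (ini := ini) hcd hd
    obtain ⟨y, -, hy⟩ := h (c :: w)
    exact hw (hatE_reads_zero.1 hy hc)
  · intro h w
    obtain ⟨y, hy⟩ := hini
    refine ⟨y, hy, ?_⟩
    cases w with
    | nil => exact reads_nil _
    | cons x w => exact hatE_reads_zero.2 fun hx => (hatE_reads_one_two h hx w).1 x .refl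

theorem observationsFrom_hatE_four (hini : ini.Nonempty) :
    (hatE P ini fin).observationsFrom {4} Set.univ = allStrings Config :=
  (unitLength_hatE.observationsFrom_eq_allStrings_iff (by simp [hatE])).2 fun w =>
    have ⟨y, hy⟩ := hini
    ⟨y, hy, hatE_reads_four y w⟩

theorem initialStateOpaque_hatE_iff (hini : ini.Nonempty) :
    (hatE P ini fin).InitialStateOpaque {4} {0} Set.univ ↔
      (hatE P ini fin).observationsFrom {0} Set.univ = allStrings Config :=
  unitLength_hatE.initialStateOpaque_iff (by simp [hatE]) (observationsFrom_hatE_four hini)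

/-! ### Reachability of `q₅` in `tildeE` -/

/-- What a state of `tildeE` that is reachable from the initial states says about the program. -/
def TildeInvariant (P : Program) (ini fin : Set Config) (s : ℕ × Config) : Prop :=
  (s.1 = 1 → ∃ c ∈ ini, ReflTransGen (stepRel P) c s.2) ∧
  (s.1 = 2 → ∃ c ∈ ini, TransGen (stepRel P) c s.2) ∧ (s.1 = 5 → Halts P ini fin)

theorem TildeInvariant.step {s t : ℕ × Config} {v : ℕ × List Config}
    (hs : TildeInvariant P ini fin s) (h : (tildeE P ini fin).Step s v t) :
    TildeInvariant P ini fin t := by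
  obtain ⟨r, hr, a, h₁, -, h₃, rfl⟩ := h
  obtain ⟨i₁, i₂, i₅⟩ := hs
  -- Only transitions entering `q₁`, `q₂` or `q₅` leave a goal: from `q₀` to `q₁`, `q₁` to `q₂`,
  -- `q₂` to `q₁`, `q₂` to `q₅`, and the loop at `q₅`.
  rcases hr with (rfl | rfl | rfl | rfl | rfl | rfl | rfl) | (rfl | rfl) <;>
    refine ⟨fun h => ?_, fun h => ?_, fun h => ?_⟩ <;> simp [trans1] at h
  · exact ⟨_, h₃, .refl⟩
  · obtain ⟨c, hc, h⟩ := i₁ h₁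
    exact ⟨c, hc, .tail' h h₃⟩
  · obtain ⟨c, hc, h⟩ := i₂ h₁
    change Fin 1 → Config at a
    have h₃ : a 0 = s.2 := h₃.2
    exact ⟨c, hc, h₃ ▸ h.to_reflTransGen⟩
  · obtain ⟨c, hc, h⟩ := i₂ h₁
    change Fin 1 → Config at a
    obtain ⟨h₃, h₄⟩ : a 0 ∈ fin ∧ a 0 = s.2 := h₃
    exact ⟨c, hc, s.2, h₄ ▸ h₃, h⟩
  · exact i₅ h₁

theorem TildeInvariant.path {s t : ℕ × Config} {u : List (ℕ × List Config)}
    (hs : TildeInvariant P ini fin s) (h : (tildeE P ini fin).Path s u t) :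
    TildeInvariant P ini fin t := by
  induction h with
  | nil => exact hs
  | cons h _ ih => exact ih (hs.step h)

theorem exists_path_tildeE {y d : Config} (h : TransGen (stepRel P) y d) (hd : d ∈ fin) :
    ∃ u z, (tildeE P ini fin).Path (1, y) u (5, z) := by
  have h₁ : ∀ {y z}, stepRel P y z → (tildeE P ini fin).Step (1, y) (2, [z]) (2, z) := fun h =>
    step_of_mem (φ := fun y x => stepRel P y x) (ξ := updStore)
      (by simp [tildeE, commonTrans]) h
  have h₂ : ∀ {z}, z ∈ fin → (tildeE P ini fin).Step (2, z) (3, [z]) (5, z) := fun h =>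
    step_of_mem (φ := fun y x => x ∈ fin ∧ x = y) (ξ := updNone)
      (by simp [tildeE, commonTrans]) ⟨h, rfl⟩
  have h₃ : ∀ {z}, z ∉ fin → (tildeE P ini fin).Step (2, z) (3, [z]) (1, z) := fun h =>
    step_of_mem (φ := fun y x => x ∉ fin ∧ x = y) (ξ := updStore)
      (by simp [tildeE, commonTrans]) ⟨h, rfl⟩
  induction h using TransGen.head_induction_on with
  | single h => exact ⟨_, _, .cons (h₁ h) (.cons (h₂ hd) (.nil _))⟩
  | @head y z h _ ih =>
    -- The run may meet a final configuration before `d`; the way back to `q₁` is then closed, but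
    -- `q₅` is entered at once.
    by_cases hz : z ∈ fin
    · exact ⟨_, _, .cons (h₁ h) (.cons (h₂ hz) (.nil _))⟩
    · obtain ⟨u, x, hu⟩ := ih
      exact ⟨_, _, .cons (h₁ h) (.cons (h₃ hz) hu)⟩

theorem reachable_tildeE_five_iff : (tildeE P ini fin).Reachable 5 ↔ Halts P ini fin := by
  constructor
  · rintro ⟨u, q₁, hq₁, q₂, hq₂, b₁, b₂, h, -⟩
    obtain rfl := Finset.mem_singleton.1 hq₁
    obtain rfl := Finset.mem_singleton.1 hq₂
    exact (TildeInvariant.path (by simp [TildeInvariant]) h).2.2 rfl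
  · rintro ⟨c, hc, d, hd, h⟩
    obtain ⟨u, z, hu⟩ := exists_path_tildeE (ini := ini) h hd
    exact ⟨_, 0, Finset.mem_singleton_self 0, 5, Finset.mem_singleton_self 5, c, z,
      .cons (step_of_mem (σ := 1) (φ := fun _ x => x ∈ ini) (ξ := updStore)
        (by simp [tildeE, commonTrans]) hc) hu, fun _ => hc⟩

end EFA

/-! ## Satisfiability of the predicates -/

namespace Pred

/-- The value of a term under a valuation of the variables. -/
def value (f : ℕ × Fin 3 → ℕ) (t : PTerm) : ℕ := t.1.elim 0 f + t.2

theorem eval_eq_value (l : List Config) (t : PTerm) :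
    PTerm.eval l t = value (fun v => (l.getD v.1 0) v.2) t := by
  rcases t with ⟨_ | ⟨i, j⟩, c⟩
  · exact (zero_add c).symm
  · rfl

/-- Denotation of a predicate under a valuation of the variables. -/
def HoldsAt (φ : Pred) (f : ℕ × Fin 3 → ℕ) : Prop :=
  ∃ cl ∈ φ, ∀ p ∈ cl, value f p.1 ≤ value f p.2

theorem sat_iff_exists_holdsAt {m : ℕ} {φ : Pred} :
    φ.Sat m ↔ ∃ f, (∀ v, m ≤ v.1 → f v = 0) ∧ φ.HoldsAt f := by
  constructor
  · rintro ⟨l, rfl, h⟩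
    refine ⟨fun v => (l.getD v.1 0) v.2, fun v hv => ?_, ?_⟩
    · simp only [List.getD_eq_default _ _ hv]
      rfl
    · simpa only [Holds, HoldsAt, eval_eq_value] using h
  · rintro ⟨f, hf, h⟩
    have hl : ∀ v : ℕ × Fin 3,
        ((List.ofFn fun (i : Fin m) j => f (i, j)).getD v.1 0) v.2 = f v := by
      intro v
      by_cases hv : v.1 < m
      · rw [List.getD_eq_getElem _ _ (by simpa using hv)]
        simp
      · rw [List.getD_eq_default _ _ (by simpa using hv)]
        exact (hf v (not_lt.1 hv)).symm
    refine ⟨List.ofFn fun (i : Fin m) j => f (i, j), List.length_ofFn, ?_⟩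
    simpa only [Holds, HoldsAt, eval_eq_value, hl] using h

/-! ### Small models of satisfiable predicates -/

open Classical in
/-- The number of those `k < x` that are at most `D` above an element of `A`. -/
noncomputable def squash (A : Finset ℕ) (D x : ℕ) : ℕ :=
  Nat.count (fun k => ∃ a ∈ A, a ≤ k ∧ k < a + D) x

/-- The counted numbers lie in a union of `A.card` intervals of length `D`. -/
theorem squash_le (A : Finset ℕ) (D x : ℕ) : squash A D x ≤ D * A.card := by
  classical
  rw [squash, Nat.count_eq_card_filter_range]
  calc _ ≤ (A.biUnion fun a => Finset.Ico a (a + D)).card := Finset.card_le_card fun k hk => by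
        simpa using (Finset.mem_filter.1 hk).2
    _ ≤ A.card * D := Finset.card_biUnion_le_card_mul _ _ _ fun a _ => by simp
    _ = D * A.card := mul_comm _ _

theorem squash_zero (A : Finset ℕ) (D : ℕ) : squash A D 0 = 0 := Nat.count_zero _

/-- For `a ≤ b` it suffices that `squash` is monotone and grows by at most one per unit. For `b ≤ a`
a gap of `a - b ≤ D` above `x` must survive, and it does because the first `D` numbers from `x ∈ A`
on are all counted. -/
theorem squash_add_le_squash_add {A : Finset ℕ} {D x y a b : ℕ} (hx : x ∈ A) (ha : a ≤ D)
    (h : x + a ≤ y + b) : squash A D x + a ≤ squash A D y + b := by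
  classical
  unfold squash
  rcases le_total a b with hab | hab
  · have h₁ := Nat.count_monotone (fun k => ∃ a ∈ A, a ≤ k ∧ k < a + D)
      (show x ≤ y + (b - a) by omega)
    rw [Nat.count_add] at h₁
    have := Nat.count_le (p := fun k => ∃ a ∈ A, a ≤ y + k ∧ y + k < a + D) (n := b - a)
    omega
  · have h₁ := Nat.count_monotone (fun k => ∃ a ∈ A, a ≤ k ∧ k < a + D)
      (show x + (a - b) ≤ y by omega)
    rw [Nat.count_add] at h₁
    have : Nat.count (fun k => ∃ a ∈ A, a ≤ x + k ∧ x + k < a + D) (a - b) = a - b := by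
      rw [Nat.count_iff_forall]
      exact fun k hk => ⟨x, hx, by omega, by omega⟩
    omega

/-- A bound on the numerals on the left-hand sides of the literals. -/
def numeralBound (φ : Pred) : ℕ := (φ.flatten.map fun p => p.1.2).sum

theorem le_numeralBound {φ : Pred} {cl : List (PTerm × PTerm)} {p : PTerm × PTerm} (hcl : cl ∈ φ)
    (hp : p ∈ cl) : p.1.2 ≤ φ.numeralBound :=
  List.le_sum_of_mem (List.mem_map.2 ⟨p, List.mem_flatten.2 ⟨cl, hcl, hp⟩, rfl⟩)

/-- Satisfiable predicates have small models. -/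
theorem exists_holdsAt_le {m : ℕ} {φ : Pred} {f : ℕ × Fin 3 → ℕ} (hf : ∀ v, m ≤ v.1 → f v = 0)
    (h : φ.HoldsAt f) : ∃ f' : ℕ × Fin 3 → ℕ, (∀ v, m ≤ v.1 → f' v = 0) ∧
      (∀ v, f' v ≤ φ.numeralBound * (3 * m + 1)) ∧ φ.HoldsAt f' := by
  -- Including `0` lets a numeral `c` be treated as `0 + c`, since `squash` fixes `0`.
  let A : Finset ℕ := insert 0 ((Finset.range m ×ˢ Finset.univ).image f)
  have hA : A.card ≤ 3 * m + 1 :=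
    (Finset.card_insert_le _ _).trans (Nat.add_le_add_right (Finset.card_image_le.trans
      (by simp [mul_comm])) 1)
  have hfA : ∀ v, f v ∈ A := fun v => by
    by_cases hv : v.1 < m
    · exact Finset.mem_insert_of_mem (Finset.mem_image_of_mem _ (by simpa using hv))
    · rw [hf v (not_lt.1 hv)]
      exact Finset.mem_insert_self _ _
  obtain ⟨cl, hcl, h⟩ := h
  refine ⟨fun v => squash A φ.numeralBound (f v), fun v hv => ?_, fun v =>
    (squash_le _ _ _).trans (Nat.mul_le_mul_left _ hA), cl, hcl, fun p hp => ?_⟩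
  · simp only [hf v hv, squash_zero]
  · have hv : ∀ t : PTerm, value (fun v => squash A φ.numeralBound (f v)) t =
        squash A φ.numeralBound (t.1.elim 0 f) + t.2 := by
      rintro ⟨_ | v, c⟩
      · simp [value, squash_zero]
      · rfl
    rw [hv, hv]
    refine squash_add_le_squash_add ?_ (le_numeralBound hcl hp) (h p hp)
    rcases p.1.1 with _ | v
    · exact Finset.mem_insert_self _ _
    · exact hfA v

/-- A bounded valuation is thus coded by a single bounded number, so the search for a model becomes
one bounded quantifier. -/
theorem exists_digits {b : ℕ} (K : ℕ) {g : ℕ → ℕ} (hg : ∀ k, g k < b) :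
    ∃ n < b ^ K, ∀ k < K, n / b ^ k % b = g k := by
  induction K generalizing g with
  | zero => exact ⟨0, by simp, by simp⟩
  | succ K ih =>
    obtain ⟨n, hn, h⟩ := ih fun k => hg (k + 1)
    have h₀ := hg 0
    refine ⟨g 0 + b * n, ?_, fun k hk => ?_⟩
    · rw [pow_succ']
      nlinarith
    · rcases k with _ | k
      · simp [Nat.mod_eq_of_lt h₀]
      · rw [pow_succ', ← Nat.div_div_eq_div_mul, Nat.add_mul_div_left _ _ (by omega),
          Nat.div_eq_of_lt h₀, zero_add]
        exact h k (by omega)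

/-- The valuation of the entries of the first `m` components with the digits of `n` in base `b`. -/
def digitVal (b m n : ℕ) (v : ℕ × Fin 3) : ℕ :=
  if v.1 < m then n / b ^ (3 * v.1 + v.2) % b else 0

theorem sat_iff_exists_lt {m : ℕ} {φ : Pred} :
    φ.Sat m ↔ ∃ cl ∈ φ, ∃ n < (φ.numeralBound * (3 * m + 1) + 1) ^ (3 * m), ∀ p ∈ cl,
      value (digitVal (φ.numeralBound * (3 * m + 1) + 1) m n) p.1 ≤
        value (digitVal (φ.numeralBound * (3 * m + 1) + 1) m n) p.2 := by
  rw [sat_iff_exists_holdsAt]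
  constructor
  · rintro ⟨f, hf, h⟩
    obtain ⟨f, hf, hB, cl, hcl, h⟩ := exists_holdsAt_le hf h
    obtain ⟨n, hn, hd⟩ := exists_digits (3 * m)
      (g := fun k => f (k / 3, ⟨k % 3, Nat.mod_lt _ (by omega)⟩)) fun k => Nat.lt_succ_of_le (hB _)
    refine ⟨cl, hcl, n, hn, ?_⟩
    have : digitVal (φ.numeralBound * (3 * m + 1) + 1) m n = f := by
      funext v
      obtain ⟨i, j⟩ := v
      unfold digitVal
      split_ifs with hv
      · rw [hd _ (by simp only at hv; omega)]
        congr 2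
        · simp only; omega
        · ext; simp only; omega
      · exact (hf _ (not_lt.1 hv)).symm
    rwa [this]
  · rintro ⟨cl, hcl, n, -, h⟩
    exact ⟨_, fun v hv => if_neg (not_lt.2 hv), cl, hcl, h⟩

theorem primrec_numeralBound : Primrec numeralBound :=
  Primrec.list_foldr (h := fun _ (p : ℕ × ℕ) => p.1 + p.2)
    (Primrec.list_map Primrec.list_flatten ((Primrec.snd.comp
      (Primrec.fst.comp Primrec.snd)).to₂)) (Primrec.const 0)
    ((Primrec.nat_add.comp (Primrec.fst.comp Primrec.snd) (Primrec.snd.comp Primrec.snd)).to₂)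

theorem primrec_value_digitVal :
    Primrec₂ fun (z : (ℕ × ℕ) × ℕ) (t : PTerm) => value (digitVal z.1.1 z.1.2 z.2) t := by
  have h : Primrec₂ fun (a : ((ℕ × ℕ) × ℕ) × PTerm) (v : ℕ × Fin 3) =>
      digitVal a.1.1.1 a.1.1.2 a.1.2 v := by
    have hb : Primrec fun q : (((ℕ × ℕ) × ℕ) × PTerm) × (ℕ × Fin 3) => q.1.1.1.1 :=
      Primrec.fst.comp (Primrec.fst.comp (Primrec.fst.comp Primrec.fst))
    have hm : Primrec fun q : (((ℕ × ℕ) × ℕ) × PTerm) × (ℕ × Fin 3) => q.1.1.1.2 :=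
      Primrec.snd.comp (Primrec.fst.comp (Primrec.fst.comp Primrec.fst))
    have hn : Primrec fun q : (((ℕ × ℕ) × ℕ) × PTerm) × (ℕ × Fin 3) => q.1.1.2 :=
      Primrec.snd.comp (Primrec.fst.comp Primrec.fst)
    have hi : Primrec fun q : (((ℕ × ℕ) × ℕ) × PTerm) × (ℕ × Fin 3) => q.2.1 :=
      Primrec.fst.comp Primrec.snd
    have hj : Primrec fun q : (((ℕ × ℕ) × ℕ) × PTerm) × (ℕ × Fin 3) => (q.2.2 : ℕ) :=
      Primrec.fin_val.comp (Primrec.snd.comp Primrec.snd)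
    exact Primrec.ite (Primrec.nat_lt.comp hi hm) (Primrec.nat_mod.comp (Primrec.nat_div.comp hn
      (primrec_pow.comp hb (Primrec.nat_add.comp (Primrec.nat_mul.comp (Primrec.const 3) hi) hj)))
      hb) (Primrec.const 0)
  exact (Primrec.nat_add.comp (Primrec.option_casesOn (Primrec.fst.comp Primrec.snd)
    (Primrec.const 0) h) (Primrec.snd.comp Primrec.snd)).of_eq fun a => by
      rcases a with ⟨z, _ | v, c⟩ <;> rfl

theorem computablePred_sat : ComputablePred fun p : ℕ × Pred => p.2.Sat p.1 := by
  have h₁ : PrimrecRel fun (q : PTerm × PTerm) (z : (ℕ × ℕ) × ℕ) =>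
      value (digitVal z.1.1 z.1.2 z.2) q.1 ≤ value (digitVal z.1.1 z.1.2 z.2) q.2 :=
    Primrec.nat_le.comp
      (primrec_value_digitVal.comp Primrec.snd (Primrec.fst.comp Primrec.fst))
      (primrec_value_digitVal.comp Primrec.snd (Primrec.snd.comp Primrec.fst))
  have h₂ : PrimrecRel fun (n : ℕ) (y : List (PTerm × PTerm) × (ℕ × ℕ)) => ∀ q ∈ y.1,
      value (digitVal y.2.1 y.2.2 n) q.1 ≤ value (digitVal y.2.1 y.2.2 n) q.2 :=
    h₁.forall_mem_list.comp (Primrec.fst.comp Primrec.snd)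
      ((Primrec.snd.comp Primrec.snd).pair Primrec.fst)
  have h₃ : PrimrecRel fun (cl : List (PTerm × PTerm)) (y : ℕ × (ℕ × ℕ)) =>
      ∃ n ∈ List.range y.1, ∀ q ∈ cl,
        value (digitVal y.2.1 y.2.2 n) q.1 ≤ value (digitVal y.2.1 y.2.2 n) q.2 :=
    h₂.exists_mem_list.comp (Primrec.list_range.comp (Primrec.fst.comp Primrec.snd))
      (Primrec.fst.pair (Primrec.snd.comp Primrec.snd))
  have hB : Primrec fun p : ℕ × Pred => p.2.numeralBound * (3 * p.1 + 1) + 1 :=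
    Primrec.succ.comp (Primrec.nat_mul.comp (primrec_numeralBound.comp Primrec.snd)
      (Primrec.succ.comp (Primrec.nat_mul.comp (Primrec.const 3) Primrec.fst)))
  have h₄ : PrimrecPred fun p : ℕ × Pred => _ := h₃.exists_mem_list.comp Primrec.snd
    ((primrec_pow.comp hB (Primrec.nat_mul.comp (Primrec.const 3) Primrec.fst)).pair
      (hB.pair Primrec.fst))
  refine (h₄.of_eq fun p => ?_).computablePred
  simp only [List.mem_range, sat_iff_exists_lt]

end Pred

/-! ## Finite descriptions of the automata built from a fixed program -/

/-- The relation between the state parameter and the event parameter is described by a predicate. -/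
def Definable (R : Config → Config → Prop) : Prop := ∃ χ : Pred, ∀ y x, χ.Holds [y, x] ↔ R y x

namespace Definable

variable {R R' : Config → Config → Prop}

theorem le (s t : PTerm) : Definable fun y x => PTerm.eval [y, x] s ≤ PTerm.eval [y, x] t :=
  ⟨[[(s, t)]], fun y x => by
    simp only [Pred.Holds, List.mem_singleton, exists_eq_left, forall_eq]⟩

theorem and (h : Definable R) (h' : Definable R') : Definable fun y x => R y x ∧ R' y x := by
  obtain ⟨φ, hφ⟩ := h
  obtain ⟨ψ, hψ⟩ := h'
  obtain ⟨χ, hχ⟩ := Pred.exists_and φ ψ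
  exact ⟨χ, fun y x => by rw [hχ, hφ, hψ]⟩

theorem or (h : Definable R) (h' : Definable R') : Definable fun y x => R y x ∨ R' y x := by
  obtain ⟨φ, hφ⟩ := h
  obtain ⟨ψ, hψ⟩ := h'
  obtain ⟨χ, hχ⟩ := Pred.exists_or φ ψ
  exact ⟨χ, fun y x => by rw [hχ, hφ, hψ]⟩

theorem not (h : Definable R) : Definable fun y x => ¬ R y x := by
  obtain ⟨φ, hφ⟩ := h
  obtain ⟨χ, hχ⟩ := Pred.exists_not φ
  exact ⟨χ, fun y x => by rw [hχ, hφ]⟩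

theorem of_iff (h : Definable R) (hR : ∀ y x, R y x ↔ R' y x) : Definable R' := by
  obtain ⟨φ, hφ⟩ := h
  exact ⟨φ, fun y x => by rw [hφ, hR]⟩

theorem const_false : Definable fun _ _ => False := ⟨[], fun y x => by simp [Pred.Holds]⟩

theorem const_true : Definable fun _ _ => True := ⟨[[]], fun y x => by simp [Pred.Holds]⟩

theorem eq (s t : PTerm) : Definable fun y x => PTerm.eval [y, x] s = PTerm.eval [y, x] t :=
  ((le s t).and (le t s)).of_iff fun _ _ => le_antisymm_iff.symm

theorem exists_lt {Q : ℕ → Config → Config → Prop} (h : ∀ i, Definable (Q i)) (n : ℕ) :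
    Definable fun y x => ∃ i < n, Q i y x := by
  induction n with
  | zero => exact const_false.of_iff fun y x => by simp
  | succ n ih =>
    refine (ih.or (h n)).of_iff fun y x => ?_
    simp only [Nat.lt_succ_iff_lt_or_eq, or_and_right, _root_.exists_or, exists_eq_left]

end Definable

/-- Entry `j` of the state parameter, plus `c`. -/
def stTerm (j : Fin 3) (c : ℕ) : PTerm := (some (0, j), c)

/-- Entry `j` of the event parameter, plus `c`. -/
def evTerm (j : Fin 3) (c : ℕ) : PTerm := (some (1, j), c)

/-- A numeral. -/
def numTerm (c : ℕ) : PTerm := (none, c)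

theorem definable_rel (I : Instr) (i : ℕ) : Definable (I.Rel i) := by
  rcases I with j | j | ⟨j, z⟩ | z
  · exact ((Definable.eq (evTerm j.castSucc 0) (stTerm j.castSucc 1)).and
      ((Definable.eq (evTerm j.rev.castSucc 0) (stTerm j.rev.castSucc 0)).and
      ((Definable.eq (stTerm 2 0) (numTerm i)).and
      (Definable.eq (evTerm 2 0) (numTerm (i + 1)))))).of_iff fun y x => .rfl
  · exact ((Definable.eq (evTerm j.castSucc 1) (stTerm j.castSucc 0)).and
      ((Definable.eq (evTerm j.rev.castSucc 0) (stTerm j.rev.castSucc 0)).and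
      ((Definable.eq (stTerm 2 0) (numTerm i)).and
      (Definable.eq (evTerm 2 0) (numTerm (i + 1)))))).of_iff fun y x => .rfl
  · have h₀ := Definable.eq (stTerm j.castSucc 0) (numTerm 0)
    -- The conditional target of the jump is split into its two cases.
    have h₁ := (h₀.and (Definable.eq (evTerm 2 0) (numTerm z))).or
      (h₀.not.and (Definable.eq (evTerm 2 0) (numTerm (i + 1))))
    refine ((Definable.eq (evTerm 0 0) (stTerm 0 0)).and
      ((Definable.eq (evTerm 1 0) (stTerm 1 0)).and
      ((Definable.eq (stTerm 2 0) (numTerm i)).and h₁))).of_iff fun y x => ?_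
    refine and_congr .rfl (and_congr .rfl (and_congr .rfl ?_))
    change (y j.castSucc = 0 ∧ x 2 = z) ∨ (y j.castSucc ≠ 0 ∧ x 2 = i + 1) ↔ _
    split_ifs with h <;> simp [h]
  · exact ((Definable.eq (evTerm 0 0) (stTerm 0 0)).and
      ((Definable.eq (evTerm 1 0) (stTerm 1 0)).and
      ((Definable.eq (stTerm 2 0) (numTerm i)).and
      (Definable.eq (evTerm 2 0) (numTerm z))))).of_iff fun y x => .rfl

theorem definable_stepRel (P : Program) : Definable (stepRel P) := by
  refine (Definable.exists_lt (Q := fun i y x => ∃ h : i < P.length, (P[i]).Rel (i + 1) y x)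
    (fun i => ?_) P.length).of_iff fun y x => ?_
  · by_cases h : i < P.length
    · exact (definable_rel P[i] (i + 1)).of_iff fun y x => by simp [h]
    · exact Definable.const_false.of_iff fun y x => by simp [h]
  · exact exists_congr fun i => ⟨fun h => h.2, fun h => ⟨h.1, h⟩⟩

theorem definable_halted (P : Program) : Definable fun _ x => x ∈ halted P :=
  ((Definable.le (numTerm 1) (evTerm 2 0)).and
    (Definable.le (evTerm 2 0) (numTerm P.length))).not.of_iff fun _ _ => .rfl

theorem definable_eq : Definable fun y x => x = y :=
  ((Definable.eq (evTerm 0 0) (stTerm 0 0)).and ((Definable.eq (evTerm 1 0) (stTerm 1 0)).and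
    (Definable.eq (evTerm 2 0) (stTerm 2 0)))).of_iff fun y x => by
      rw [funext_iff, Fin.forall_fin_succ, Fin.forall_fin_succ, Fin.forall_fin_one]
      rfl

/-! ### Comparison with a given configuration, computably in that configuration -/

namespace Pred

/-- The literal stating that entry `j` of component `k`, plus `c`, is at most `a j`. -/
def leLit (k : ℕ) (j : Fin 3) (c : ℕ) (a : Config) : PTerm × PTerm :=
  ((some (k, j), c), (none, a j))

/-- The literal stating that entry `j` of component `k` is at least `a j + c`. -/
def geLit (k : ℕ) (j : Fin 3) (c : ℕ) (a : Config) : PTerm × PTerm :=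
  ((none, a j + c), (some (k, j), 0))

/-- Component `k` equals `a`. -/
def eqConst (k : ℕ) (a : Config) : Pred :=
  [[leLit k 0 0 a, geLit k 0 0 a, leLit k 1 0 a, geLit k 1 0 a, leLit k 2 0 a, geLit k 2 0 a]]

/-- Component `k` differs from `a`. -/
def neConst (k : ℕ) (a : Config) : Pred :=
  [[leLit k 0 1 a], [geLit k 0 1 a], [leLit k 1 1 a], [geLit k 1 1 a], [leLit k 2 1 a],
    [geLit k 2 1 a]]

theorem holds_eqConst {k : ℕ} {a : Config} {l : List Config} :
    (eqConst k a).Holds l ↔ l.getD k 0 = a := by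
  rw [funext_iff, Fin.forall_fin_succ, Fin.forall_fin_succ, Fin.forall_fin_one]
  simp only [Holds, eqConst, leLit, geLit, PTerm.eval, List.mem_singleton, exists_eq_left,
    List.forall_mem_cons, forall_eq, Fin.succ_zero_eq_one, Fin.succ_one_eq_two]
  omega

theorem holds_neConst {k : ℕ} {a : Config} {l : List Config} :
    (neConst k a).Holds l ↔ l.getD k 0 ≠ a := by
  rw [ne_eq, funext_iff, Fin.forall_fin_succ, Fin.forall_fin_succ, Fin.forall_fin_one]
  simp only [Holds, neConst, leLit, geLit, PTerm.eval, List.exists_mem_cons_iff,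
    List.forall_mem_cons, List.not_mem_nil, false_imp_iff, implies_true, and_true, false_and,
    exists_false, or_false, Fin.succ_zero_eq_one, Fin.succ_one_eq_two]
  omega

theorem primrec_leLit (k : ℕ) (j : Fin 3) (c : ℕ) : Primrec (leLit k j c) :=
  (Primrec.const _).pair ((Primrec.const _).pair (Primrec.fin_app.comp .id (Primrec.const j)))

theorem primrec_geLit (k : ℕ) (j : Fin 3) (c : ℕ) : Primrec (geLit k j c) :=
  ((Primrec.const _).pair (Primrec.nat_add.comp (Primrec.fin_app.comp .id (Primrec.const j))
    (Primrec.const c))).pair (Primrec.const _)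

theorem primrec_eqConst (k : ℕ) : Primrec (eqConst k) :=
  Primrec.list_cons.comp (Primrec.list_cons.comp (primrec_leLit k 0 0) <|
    Primrec.list_cons.comp (primrec_geLit k 0 0) <| Primrec.list_cons.comp (primrec_leLit k 1 0) <|
    Primrec.list_cons.comp (primrec_geLit k 1 0) <| Primrec.list_cons.comp (primrec_leLit k 2 0) <|
    Primrec.list_cons.comp (primrec_geLit k 2 0) <| Primrec.const []) (Primrec.const [])

theorem primrec_neConst (k : ℕ) : Primrec (neConst k) := by
  have h : ∀ {f : Config → PTerm × PTerm}, Primrec f → Primrec fun a => [f a] := fun hf =>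
    Primrec.list_cons.comp hf (Primrec.const [])
  exact Primrec.list_cons.comp (h (primrec_leLit k 0 1)) <|
    Primrec.list_cons.comp (h (primrec_geLit k 0 1)) <|
    Primrec.list_cons.comp (h (primrec_leLit k 1 1)) <|
    Primrec.list_cons.comp (h (primrec_geLit k 1 1)) <|
    Primrec.list_cons.comp (h (primrec_leLit k 2 1)) <|
    Primrec.list_cons.comp (h (primrec_geLit k 2 1)) <| Primrec.const []

end Pred

namespace TransCode

theorem toTrans_store {q σ q' : ℕ} {χ : Pred} {φ : Config → Config → Prop}
    (h : ∀ y x, χ.Holds [y, x] ↔ φ y x) :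
    (⟨q, σ, 1, χ, fun j => evTerm j 0, q'⟩ : TransCode).toTrans = trans1 q σ φ updStore q' := by
  unfold toTrans trans1
  congr 1
  ext p
  exact h p.1 (p.2 0)

theorem toTrans_none {q σ q' : ℕ} {χ : Pred} {φ : Config → Config → Prop}
    (h : ∀ y x, χ.Holds [y, x] ↔ φ y x) :
    (⟨q, σ, 1, χ, fun j => stTerm j 0, q'⟩ : TransCode).toTrans = trans1 q σ φ updNone q' := by
  unfold toTrans trans1
  congr 1
  ext p
  exact h p.1 (p.2 0)

end TransCode

/-- The description of an instance with the states, events and initial states of `hatE`. -/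
def hatInstance (Y0 : Pred) (trans : List TransCode) : OpacityInstance :=
  -- The last predicate is a single empty conjunction, hence true: all data are observable.
  ⟨[0, 1, 2, 3, 4], [1, 2, 3, 4, 5], [0, 4], [], Y0, trans, [4], [0], [[]]⟩

theorem primrec_transCode {α : Type*} [Primcodable α] {φ : α → Pred} (hφ : Primrec φ)
    (q σ k q' : ℕ) (ξ : Fin 3 → PTerm) :
    Primrec fun a => (⟨q, σ, k, φ a, ξ, q'⟩ : TransCode) := by
  have h : Primrec fun a => (q, σ, k, φ a, ξ, q') :=
    (Primrec.const q).pair ((Primrec.const σ).pair ((Primrec.const k).pair (hφ.pair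
      (Primrec.const (ξ, q')))))
  exact (Primrec.of_equiv_symm (e := TransCode.equivProd)).comp h

theorem primrec_hatInstance {α : Type*} [Primcodable α] {Y0 : α → Pred} {t : α → List TransCode}
    (hY : Primrec Y0) (ht : Primrec t) : Primrec fun a => hatInstance (Y0 a) (t a) := by
  have h : Primrec fun a => (([0, 1, 2, 3, 4] : List ℕ), ([1, 2, 3, 4, 5] : List ℕ),
      ([0, 4] : List ℕ), ([] : List ℕ), Y0 a, t a, ([4] : List ℕ), ([0] : List ℕ),
      ([[]] : Pred)) :=
    (Primrec.const _).pair ((Primrec.const _).pair ((Primrec.const _).pair ((Primrec.const _).pair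
      (hY.pair (ht.pair (Primrec.const _))))))
  exact (Primrec.of_equiv_symm (e := OpacityInstance.equivProd)).comp h

/-- For a fixed program, descriptions of `hatE` are computable from the initial configuration. -/
theorem exists_computable_instance (P : Program) : ∃ I : Config → OpacityInstance, Computable I ∧
    ∀ a, ∃ h : (I a).WF, (I a).IsOpaque h ↔
      (hatE P {a} (halted P)).InitialStateOpaque {4} {0} Set.univ := by
  -- As `P` is fixed, these predicates do not depend on `a`; their mere existence suffices for
  -- computability.
  obtain ⟨s, hs⟩ := definable_stepRel P
  obtain ⟨s', hs'⟩ := (definable_stepRel P).not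
  obtain ⟨f, hf⟩ := (definable_halted P).not.and definable_eq
  obtain ⟨e, he⟩ := definable_eq.not
  obtain ⟨t, ht⟩ := Definable.const_true
  let R : List TransCode :=
    [⟨1, 2, 1, s, fun j => evTerm j 0, 2⟩, ⟨1, 2, 1, s', fun j => stTerm j 0, 3⟩,
      ⟨2, 3, 1, f, fun j => evTerm j 0, 1⟩, ⟨2, 3, 1, e, fun j => stTerm j 0, 3⟩,
      ⟨3, 4, 1, t, fun j => stTerm j 0, 3⟩, ⟨4, 5, 1, t, fun j => stTerm j 0, 4⟩]
  let T : Config → List TransCode := fun a =>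
    ⟨0, 1, 1, Pred.eqConst 1 a, fun j => evTerm j 0, 1⟩ ::
      ⟨0, 1, 1, Pred.neConst 1 a, fun j => stTerm j 0, 3⟩ :: R
  have hT : Primrec T := Primrec.list_cons.comp (primrec_transCode (Pred.primrec_eqConst 1) ..) <|
    Primrec.list_cons.comp (primrec_transCode (Pred.primrec_neConst 1) ..) (Primrec.const R)
  refine ⟨fun a => hatInstance (Pred.eqConst 0 a) (T a),
    (primrec_hatInstance (Pred.primrec_eqConst 0) hT).to_comp, fun a => ?_⟩
  have hwf : (hatInstance (Pred.eqConst 0 a) (T a)).WF := by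
    constructor <;> simp [hatInstance, T, R]
  refine ⟨hwf, ?_⟩
  have hE : (hatInstance (Pred.eqConst 0 a) (T a)).toEFA hwf = hatE P {a} (halted P) := by
    unfold OpacityInstance.toEFA hatE
    congr 1
    · ext y
      simp [hatInstance, Pred.holds_eqConst]
    · ext r
      have h₁ : ∀ y x : Config, (Pred.eqConst 1 a).Holds [y, x] ↔ x ∈ ({a} : Set Config) :=
        fun y x => Pred.holds_eqConst
      have h₂ : ∀ y x : Config, (Pred.neConst 1 a).Holds [y, x] ↔ x ∉ ({a} : Set Config) :=
        fun y x => Pred.holds_neConst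
      simp only [hatInstance, T, R, commonTrans, Set.mem_ofPred_eq, List.exists_mem_cons_iff,
        List.not_mem_nil, false_and, exists_false, or_false, Set.mem_union, Set.mem_insert_iff,
        Set.mem_singleton_iff, or_assoc, TransCode.toTrans_store h₁, TransCode.toTrans_none h₂,
        TransCode.toTrans_store hs, TransCode.toTrans_none hs', TransCode.toTrans_store hf,
        TransCode.toTrans_none he, TransCode.toTrans_none ht, ne_eq]
      exact .rfl
  have hvis : {x | (hatInstance (Pred.eqConst 0 a) (T a)).vis.Holds [x]} = Set.univ := by
    ext x
    simp [hatInstance, Pred.Holds]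
  rw [OpacityInstance.IsOpaque, hE, hvis]
  rfl

theorem theorem2 :
    -- satisfiability of the predicates is decidable
    (ComputablePred fun p : ℕ × Pred => p.2.Sat p.1) ∧
    -- initial-state opacity of (finitely described) EFAs is undecidable
    (¬ ∃ f : OpacityInstance → Bool, Computable f ∧
      ∀ (I : OpacityInstance) (h : I.WF), f I = true ↔ I.IsOpaque h) ∧
    -- the automata built from two-counter machines, under the identity observation
    (∀ (P : Program) (ini fin : Set Config), ini.Nonempty →
      (hatE P ini fin).observationsFrom {4} Set.univ = allStrings Config ∧
      ((hatE P ini fin).InitialStateOpaque {4} {0} Set.univ ↔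
        (hatE P ini fin).observationsFrom {0} Set.univ = allStrings Config) ∧
      ((hatE P ini fin).observationsFrom {0} Set.univ = allStrings Config ↔
        ¬ (tildeE P ini fin).Reachable 5) ∧
      ((tildeE P ini fin).Reachable 5 ↔ Halts P ini fin)) ∧
    -- already for these automata initial-state opacity is undecidable
    (¬ ComputablePred fun p : Program × Config =>
      (hatE p.1 {p.2} (halted p.1)).InitialStateOpaque {4} {0} Set.univ) := by
  obtain ⟨P, hP⟩ := exists_program_halts_undecidable
  have hopacity : ∀ a, (hatE P {a} (halted P)).InitialStateOpaque {4} {0} Set.univ ↔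
      ¬ Halts P {a} (halted P) := fun a => by
    rw [EFA.initialStateOpaque_hatE_iff (Set.singleton_nonempty a),
      EFA.observationsFrom_hatE_zero_iff (Set.singleton_nonempty a)]
  refine ⟨Pred.computablePred_sat, ?_, fun P ini fin hini => ?_, ?_⟩
  · rintro ⟨f, hf, h⟩
    obtain ⟨I, hI, hIa⟩ := exists_computable_instance P
    refine hP ⟨fun a => f (I a), hf.comp hI, fun a => ?_⟩
    obtain ⟨hwf, ha⟩ := hIa a
    rw [h _ hwf, ha, hopacity]
  · exact ⟨EFA.observationsFrom_hatE_four hini, EFA.initialStateOpaque_hatE_iff hini,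
      by rw [EFA.observationsFrom_hatE_zero_iff hini, EFA.reachable_tildeE_five_iff],
      EFA.reachable_tildeE_five_iff⟩
  · rintro ⟨_, h⟩
    -- A decision procedure for all programs is specialized to the fixed program `P`.
    refine hP ⟨_, h.comp ((Computable.const P).pair .id), fun a => ?_⟩
    rw [decide_eq_true_iff]
    exact hopacity a
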